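/- For every $n\in\mathbb N$ let $\mathcal H_n$ be a finite-dimensional complex Hilbert space (identified with $\mathbb C^{d_n}$, so that operators are matrices), let $\sigma_n$ be a density operator on $\mathcal H_n$, and let $\mathcal N_n=\{\rho_{1,n},\dots,\rho_{r,n}\}$ be density operators on $\mathcal H_n$, where $r\ge 1$ does not depend on $n$. Assume that $\operatorname{supp}\rho_{i,n}\subseteq\operatorname{supp}\sigma_n$ for all $i,n$; no independence or product structure is assumed. Notation. Powers of a positive semidefinite operator are taken on its support only (so $A^0$ is the support projection), $\log 0:=-\infty$, and limsup, liminf, sup, max, min are taken in $[-\infty,+\infty]$. For $t>0$ put $Q_t^{\mathrm{old}}(\rho\|\sigma)=\operatorname{Tr}\rho^t\sigma^{1-t}$ and $Q_t^{\mathrm{new}}(\rho\|\sigma)=\operatorname{Tr}\big(\sigma^{\frac{1-t}{2t}}\rho\,\sigma^{\frac{1-t}{2t}}\big)^t$, and for $t\in(0,1)$ put $D_t^{\mathrm{new}}(\rho\|\sigma)=\frac1{t-1}\log Q_t^{\mathrm{new}}(\rho\|\sigma)-\frac1{t-1}\log\operatorname{Tr}\rho$. A test is an operator $T$ with $0\le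 T\le I$; its errors are $\alpha_n(T)=\sup_{\rho\in\mathcal N_n}\operatorname{Tr}\rho(I-T)$ and $\beta_n(T)=\operatorname{Tr}\sigma_nT$. A real number $R\ge0$ is achievable if there are tests $T_n$ on $\mathcal H_n$ with $\lim_n\alpha_n(T_n)=0$ and $\limsup_n\frac1n\log\beta_n(T_n)\le -R$; the direct rate $R(\{\mathcal N_n\}\|\{\sigma_n\})\in[0,+\infty]$ is the supremum of the achievable rates. For $a\in\mathbb R$ let $S_{n,a}=\{e^{-na}\sum_{i}\rho_{i,n}-\sigma_n>0\}$ (the spectral projection onto the positive part), and put $\psi^{\mathrm{new}}_i(t)=\limsup_n\frac1n\log Q_t^{\mathrm{new}}(\rho_{i,n}\|\sigma_n)$ and $\psi_i^{\mathrm{old}}(t)=\limsup_n\frac1n\log Q_t^{\mathrm{old}}(\rho_{i,n}\|\sigma_n)$. Theorem. (1) For every $a\in\mathbb R$, $$\limsup_{n\to\infty}\tfrac1n\log\alpha_n(S_{n,a})\le-\sup_{0<t<1}\Big\{a(t-1)-\max_{1\le i\le r}\psi_i^{\mathrm{new}}(t)\Big\},$$ $$\limsup_{n\to\infty}\tfrac1n\log\beta_n(S_{n,a})\le-\sup_{0<t<1}\Big\{at-\max_{1\le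 i\le r}\psi_i^{\mathrm{new}}(t)\Big\}\le -a.$$ (2) $$R(\{\mathcal N_n\}\|\{\sigma_n\})\ge\sup_{0<t<1}\min_{1\le i\le r}\liminf_{n\to\infty}\tfrac1nD_t^{\mathrm{new}}(\rho_{i,n}\|\sigma_n).$$ (3) If $\limsup_{n}\frac1n\log\dim\mathcal H_n<+\infty$, then for every $i$ the left derivative $\partial^-\psi_i^{\mathrm{old}}(1)=\lim_{t\nearrow1}\frac{\psi_i^{\mathrm{old}}(t)-\psi_i^{\mathrm{old}}(1)}{t-1}$ exists in $[-\infty,+\infty]$, and $$R(\{\mathcal N_n\}\|\{\sigma_n\})\ge\min_{1\le i\le r}\partial^-\psi_i^{\mathrm{old}}(1).$$ -/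

import Mathlib

open Filter Topology Matrix
open scoped ComplexOrder

/-! Operators on a finite-dimensional Hilbert space are complex matrices over a finite index
type. -/

namespace QHT

noncomputable section

variable {ι : Type*} [Fintype ι] [DecidableEq ι]

/-- The logarithm of a nonnegative real, with `log 0 = -∞`. -/
def elog (x : ℝ) : EReal := ENNReal.log (ENNReal.ofReal x)

/-- The (real) trace of an operator. -/
def rtr (A : Matrix ι ι ℂ) : ℝ := (A.trace).re

/-- Density operators. -/
def IsState (ρ : Matrix ι ι ℂ) : Prop := ρ.PosSemidef ∧ ρ.trace = 1

/-- Tests: operators with `0 ≤ T ≤ I`. -/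
def IsTest (T : Matrix ι ι ℂ) : Prop := T.PosSemidef ∧ (1 - T).PosSemidef

/-- The support of a self-adjoint operator, i.e. its range. -/
def supp (A : Matrix ι ι ℂ) : Submodule ℂ (ι → ℂ) := LinearMap.range A.mulVecLin

/-- The power `A ^ α` of a positive semidefinite operator, taken on the support of `A` only, through
the spectral decomposition of `A`; in particular `A ^ 0` is the projection onto the support.
(The spectrum is finite, so that every function is continuous on it.) -/
def mpow (A : Matrix ι ι ℂ) (α : ℝ) : Matrix ι ι ℂ :=
  cfc (fun x : ℝ => if 0 < x then x ^ α else 0) A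

/-- The spectral projection `{X > 0}` of a self-adjoint operator. -/
def posProj (X : Matrix ι ι ℂ) : Matrix ι ι ℂ :=
  cfc (fun x : ℝ => if 0 < x then (1 : ℝ) else 0) X

/-- `Q_α^{(old)}(ρ‖σ) = Tr ρ^α σ^{1-α}`. -/
def Qold (α : ℝ) (ρ σ : Matrix ι ι ℂ) : ℝ := rtr (mpow ρ α * mpow σ (1 - α))

/-- `Q_α^{(new)}(ρ‖σ) = Tr (σ^{(1-α)/(2α)} ρ σ^{(1-α)/(2α)})^α`. -/
def Qnew (α : ℝ) (ρ σ : Matrix ι ι ℂ) : ℝ :=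
  rtr (mpow (mpow σ ((1 - α) / (2 * α)) * ρ * mpow σ ((1 - α) / (2 * α))) α)

open Classical in
/-- The new (sandwiched) Rényi divergence `D_α^{(new)}(ρ‖σ)`, for `α ∈ (0, ∞) \ {1}`. -/
def Dnew (α : ℝ) (ρ σ : Matrix ι ι ℂ) : EReal :=
  if (0 < α ∧ α < 1) ∨ supp ρ ≤ supp σ then
    (((α - 1)⁻¹ : ℝ) : EReal) * elog (Qnew α ρ σ) - (((α - 1)⁻¹ : ℝ) : EReal) * elog (rtr ρ)
  else ⊤

/-- Type I error: the supremum over the null hypothesis `N` of `Tr ρ (I - T)`. -/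
def typeI (N : Set (Matrix ι ι ℂ)) (T : Matrix ι ι ℂ) : ℝ :=
  sSup ((fun ρ => rtr (ρ * (1 - T))) '' N)

/-- Type II error: `Tr σ T`. -/
def typeII (σ T : Matrix ι ι ℂ) : ℝ := rtr (σ * T)

/-- `limsup_n (1/n) log x_n`, in the extended reals. -/
def limsupRate (x : ℕ → ℝ) : EReal :=
  limsup (fun n : ℕ => (((n : ℝ)⁻¹ : ℝ) : EReal) * elog (x n)) atTop

/-- The one-sided limit of the difference quotients of an extended-real-valued function from the
left at `x` exists in the extended reals and equals `d`. -/
def HasLeftDeriv (f : ℝ → EReal) (x : ℝ) (d : EReal) : Prop :=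
  Tendsto (fun t : ℝ => (f t - f x) / ((t - x : ℝ) : EReal)) (𝓝[<] x) (𝓝 d)

end

noncomputable section

variable {ι : ℕ → Type*} [∀ n, Fintype (ι n)] [∀ n, DecidableEq (ι n)]

/-- Achievability of a rate `R ≥ 0` for the null hypotheses `N n` against `σ n`. -/
def IsAchievable (N : ∀ n, Set (Matrix (ι n) (ι n) ℂ)) (σ : ∀ n, Matrix (ι n) (ι n) ℂ)
    (R : ℝ) : Prop :=
  0 ≤ R ∧ ∃ T : ∀ n, Matrix (ι n) (ι n) ℂ, (∀ n, IsTest (T n)) ∧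
    Tendsto (fun n => typeI (N n) (T n)) atTop (𝓝 0) ∧
    limsupRate (fun n => typeII (σ n) (T n)) ≤ ((-R : ℝ) : EReal)

/-- The direct rate: the supremum in `[0, ∞]` of the achievable rates. -/
def directRate (N : ∀ n, Set (Matrix (ι n) (ι n) ℂ)) (σ : ∀ n, Matrix (ι n) (ι n) ℂ) : EReal :=
  sSup {x : EReal | ∃ R : ℝ, IsAchievable N σ R ∧ x = (R : EReal)}

/-- The Neyman–Pearson test `S_{n,a} = {e^{-na} ∑ i, ρ_{i,n} - σ_n > 0}`. -/
def npTest {r : ℕ} (ρ : Fin r → ∀ n, Matrix (ι n) (ι n) ℂ) (σ : ∀ n, Matrix (ι n) (ι n) ℂ)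
    (n : ℕ) (a : ℝ) : Matrix (ι n) (ι n) ℂ :=
  posProj (Real.exp (-(n * a)) • (∑ i, ρ i n) - σ n)

/-- `ψ_i^{(old)}(t) = limsup_n (1/n) log Q_t^{(old)}(ρ_{i,n}‖σ_n)`, for one sequence `ρ`. -/
def psiOld (ρ σ : ∀ n, Matrix (ι n) (ι n) ℂ) (t : ℝ) : EReal :=
  limsupRate (fun n => Qold t (ρ n) (σ n))

/-- `limsup_n (1/n) log Q_t^{(new)}(ρ_n‖σ_n)`. -/
def psiNew (ρ σ : ∀ n, Matrix (ι n) (ι n) ℂ) (t : ℝ) : EReal :=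
  limsupRate (fun n => Qnew t (ρ n) (σ n))

end

end QHT

/-!
The test `{A - B > 0}` minimises `Tr A (I - T) + Tr B T` over all tests `T`, and the minimum is at
most `2 Q_t^{new}(A‖B)`: for `t ≤ 1/2` a suitable spectral projection already achieves this, while
for `t ≥ 1/2` Audenaert's inequality bounds the minimum by `Q_t^{old}`, and `Q_t^{old} ≤ Q_t^{new}`
is the Araki–Lieb–Thirring inequality, obtained by complex interpolation. With `A` a multiple of
`∑ i, ρ_i`, subadditivity of `X ↦ Tr X ^ t` replaces `Q_t^{new}(∑ i, ρ_i‖σ)` by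
`∑ i, Q_t^{new}(ρ_i‖σ)`, and a factor `r` does not affect exponents.

For the left derivatives, Hölder's inequality shows that `log Q_t^{old}(ρ‖σ) / (t - 1)` is monotone
in `t < 1`, so that the one-sided limit exists. Conversely to Araki–Lieb–Thirring, `Q_t^{new}` is at
most `(Q_t^{old}) ^ t` times `(dim ℋ) ^ ((1 - t) ^ 2)`; this is a power of the dimension whose
exponent vanishes to second order at `t = 1`, so at most exponential growth of the dimension is
negligible in `log Q_t^{new} / (t - 1)` as `t → 1`.
-/

namespace QHT

open scoped MatrixOrder Matrix.Norms.L2Operator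

section Trace

variable {ι : Type*} [Fintype ι] {A B C : Matrix ι ι ℂ}

theorem rtr_add (A B : Matrix ι ι ℂ) : rtr (A + B) = rtr A + rtr B := by
  simp [rtr]

theorem rtr_sub (A B : Matrix ι ι ℂ) : rtr (A - B) = rtr A - rtr B := by
  simp [rtr]

theorem rtr_smul (c : ℝ) (A : Matrix ι ι ℂ) : rtr (c • A) = c * rtr A := by
  simp [rtr]

theorem rtr_sum {κ : Type*} (s : Finset κ) (A : κ → Matrix ι ι ℂ) :
    rtr (∑ i ∈ s, A i) = ∑ i ∈ s, rtr (A i) := by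
  simp [rtr, trace_sum]

theorem rtr_mul_comm (A B : Matrix ι ι ℂ) : rtr (A * B) = rtr (B * A) :=
  congrArg Complex.re (trace_mul_comm A B)

theorem continuous_rtr : Continuous (rtr : Matrix ι ι ℂ → ℝ) :=
  Complex.continuous_re.comp continuous_id.matrix_trace

theorem rtr_nonneg (hA : A.PosSemidef) : 0 ≤ rtr A :=
  (Complex.le_def.1 hA.trace_nonneg).1

theorem IsState.rtr_eq_one (hA : IsState A) : rtr A = 1 := by
  rw [rtr, hA.2, Complex.one_re]

theorem rtr_mono (h : A ≤ B) : rtr A ≤ rtr B := by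
  have := rtr_nonneg (Matrix.le_iff.1 h)
  rwa [rtr_sub, sub_nonneg] at this

theorem conj_posSemidef (hC : C.IsHermitian) (hA : A.PosSemidef) : (C * A * C).PosSemidef := by
  simpa only [hC.eq] using hA.mul_mul_conjTranspose_same C

theorem conj_posDef (hC : C.PosDef) (hA : A.PosDef) : (C * A * C).PosDef := by
  classical
  exact (conj_posSemidef hC.1 hA.posSemidef).posDef_iff_isUnit.2
    ((hC.isUnit.mul hA.isUnit).mul hC.isUnit)

theorem conj_mono (hC : C.IsHermitian) (h : A ≤ B) : C * A * C ≤ C * B * C := by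
  rw [Matrix.le_iff] at h ⊢
  simpa only [mul_sub, sub_mul] using conj_posSemidef hC h

theorem rtr_mul_nonneg (hA : A.PosSemidef) (hB : B.PosSemidef) : 0 ≤ rtr (A * B) := by
  classical
  obtain ⟨C, rfl⟩ := CStarAlgebra.nonneg_iff_eq_star_mul_self.1 hA.nonneg
  rw [mul_assoc, rtr_mul_comm]
  exact rtr_nonneg (hB.mul_mul_conjTranspose_same C)

theorem rtr_mul_le_rtr_mul (hC : C.PosSemidef) (h : A ≤ B) : rtr (C * A) ≤ rtr (C * B) := by
  have := rtr_mul_nonneg hC (Matrix.le_iff.1 h)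
  rwa [mul_sub, rtr_sub, sub_nonneg] at this

end Trace

section Spectral

variable {ι : Type*} [Fintype ι] [DecidableEq ι] {A B : Matrix ι ι ℂ}

theorem continuousOn_spectrum (A : Matrix ι ι ℂ) (f : ℝ → ℝ) : ContinuousOn f (spectrum ℝ A) :=
  A.finite_real_spectrum.continuousOn f

theorem continuousOn_image_spectrum (A : Matrix ι ι ℂ) (f g : ℝ → ℝ) :
    ContinuousOn g (f '' spectrum ℝ A) :=
  (A.finite_real_spectrum.image f).continuousOn g

theorem spectrum_nonneg (hA : A.PosSemidef) {x : ℝ} (hx : x ∈ spectrum ℝ A) : 0 ≤ x :=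
  spectrum_nonneg_of_nonneg hA.nonneg hx

theorem spectrum_pos (hA : A.PosDef) {x : ℝ} (hx : x ∈ spectrum ℝ A) : 0 < x := by
  rw [hA.1.spectrum_real_eq_range_eigenvalues] at hx
  obtain ⟨i, rfl⟩ := hx
  exact hA.eigenvalues_pos i

theorem cfc_isHermitian (f : ℝ → ℝ) (A : Matrix ι ι ℂ) : (cfc f A).IsHermitian :=
  cfc_predicate f A

theorem cfc_eq_mul_diagonal_mul (hA : A.IsHermitian) (f : ℝ → ℝ) :
    cfc f A = (hA.eigenvectorUnitary : Matrix ι ι ℂ) *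
      diagonal (fun i => ((f (hA.eigenvalues i) : ℝ) : ℂ)) *
      (hA.eigenvectorUnitary : Matrix ι ι ℂ)ᴴ := by
  rw [hA.cfc_eq, IsHermitian.cfc, Unitary.conjStarAlgAut_apply]
  rfl

theorem rtr_cfc_mul (hA : A.IsHermitian) (f : ℝ → ℝ) (M : Matrix ι ι ℂ) :
    rtr (cfc f A * M) = ∑ i, f (hA.eigenvalues i) *
      (((hA.eigenvectorUnitary : Matrix ι ι ℂ)ᴴ * M *
        (hA.eigenvectorUnitary : Matrix ι ι ℂ)) i i).re := by
  rw [cfc_eq_mul_diagonal_mul hA, mul_assoc, mul_assoc, rtr_mul_comm, mul_assoc, rtr, trace]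
  simp [diagonal_mul]

theorem rtr_cfc (hA : A.IsHermitian) (f : ℝ → ℝ) :
    rtr (cfc f A) = ∑ i, f (hA.eigenvalues i) := by
  simpa [← star_eq_conjTranspose] using rtr_cfc_mul hA f 1

theorem diag_mul_cfc_mul (hB : B.IsHermitian) (g : ℝ → ℝ) (M : Matrix ι ι ℂ) (i : ι) :
    ((M * cfc g B * Mᴴ) i i).re = ∑ j, g (hB.eigenvalues j) *
      ‖(M * (hB.eigenvectorUnitary : Matrix ι ι ℂ)) i j‖ ^ 2 := by
  set V := (hB.eigenvectorUnitary : Matrix ι ι ℂ)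
  have hV : M * cfc g B * Mᴴ =
      (M * V) * diagonal (fun i => ((g (hB.eigenvalues i) : ℝ) : ℂ)) * (M * V)ᴴ := by
    simp only [cfc_eq_mul_diagonal_mul hB, conjTranspose_mul, mul_assoc, V]
  rw [hV, mul_apply, Complex.re_sum]
  refine Finset.sum_congr rfl fun j _ => ?_
  rw [mul_diagonal, conjTranspose_apply, ← Complex.normSq_eq_norm_sq, Complex.normSq_apply]
  simp
  ring

theorem sum_norm_sq_row {V : Matrix ι ι ℂ} (hV : V ∈ unitary (Matrix ι ι ℂ)) (i : ι) :
    ∑ j, ‖V i j‖ ^ 2 = 1 := by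
  have h : ((V * Vᴴ) i i).re = ((1 : Matrix ι ι ℂ) i i).re := by
    rw [← star_eq_conjTranspose, Unitary.mul_star_self_of_mem hV]
  rw [mul_apply, one_apply_eq] at h
  simpa [← Complex.normSq_eq_norm_sq, Complex.normSq_apply] using h

theorem sum_norm_sq_col {V : Matrix ι ι ℂ} (hV : V ∈ unitary (Matrix ι ι ℂ)) (j : ι) :
    ∑ i, ‖V i j‖ ^ 2 = 1 := by
  simpa [star_eq_conjTranspose] using sum_norm_sq_row (Unitary.star_mem hV) j

/-- The squared moduli of the inner products of the eigenvectors of `A` and `B`: a doubly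
stochastic matrix through which `Tr f(A) g(B)` depends on the eigenvalues only. -/
noncomputable def overlap (hA : A.IsHermitian) (hB : B.IsHermitian) (i j : ι) : ℝ :=
  ‖((hA.eigenvectorUnitary : Matrix ι ι ℂ)ᴴ * (hB.eigenvectorUnitary : Matrix ι ι ℂ)) i j‖ ^ 2

theorem overlap_nonneg (hA : A.IsHermitian) (hB : B.IsHermitian) (i j : ι) :
    0 ≤ overlap hA hB i j :=
  sq_nonneg _

theorem sum_overlap_right (hA : A.IsHermitian) (hB : B.IsHermitian) (i : ι) :
    ∑ j, overlap hA hB i j = 1 :=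
  sum_norm_sq_row (star hA.eigenvectorUnitary * hB.eigenvectorUnitary).2 i

theorem sum_overlap_left (hA : A.IsHermitian) (hB : B.IsHermitian) (j : ι) :
    ∑ i, overlap hA hB i j = 1 :=
  sum_norm_sq_col (star hA.eigenvectorUnitary * hB.eigenvectorUnitary).2 j

theorem rtr_cfc_mul_cfc (hA : A.IsHermitian) (hB : B.IsHermitian) (f g : ℝ → ℝ) :
    rtr (cfc f A * cfc g B) = ∑ i, ∑ j, f (hA.eigenvalues i) * g (hB.eigenvalues j) *
      overlap hA hB i j := by
  rw [rtr_cfc_mul hA]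
  refine Finset.sum_congr rfl fun i _ => ?_
  have h := diag_mul_cfc_mul hB g (hA.eigenvectorUnitary : Matrix ι ι ℂ)ᴴ i
  rw [conjTranspose_conjTranspose] at h
  rw [h, Finset.mul_sum]
  exact Finset.sum_congr rfl fun j _ => (mul_assoc _ _ _).symm

theorem rtr_cfc_mul_comm {C D : Matrix ι ι ℂ} (hCD : (C * D).IsHermitian)
    (hDC : (D * C).IsHermitian) (f : ℝ → ℝ) : rtr (cfc f (C * D)) = rtr (cfc f (D * C)) := by
  have rtr_cfc_eq_sum_roots {M : Matrix ι ι ℂ} (hM : M.IsHermitian) :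
      rtr (cfc f M) = (M.charpoly.roots.map (fun z => f z.re)).sum := by
    rw [rtr_cfc hM, hM.roots_charpoly_eq_eigenvalues, Multiset.map_map]
    rfl
  rw [rtr_cfc_eq_sum_roots hCD, rtr_cfc_eq_sum_roots hDC, charpoly_mul_comm]

end Spectral

section Powers

variable {ι : Type*} [Fintype ι] [DecidableEq ι] {A B C : Matrix ι ι ℂ}

theorem mpow_isHermitian (A : Matrix ι ι ℂ) (α : ℝ) : (mpow A α).IsHermitian :=
  cfc_isHermitian _ _

theorem mpow_posSemidef (A : Matrix ι ι ℂ) (α : ℝ) : (mpow A α).PosSemidef := by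
  refine Matrix.nonneg_iff_posSemidef.1 (cfc_nonneg fun x _ => ?_)
  split_ifs with h
  · exact (Real.rpow_pos_of_pos h _).le
  · exact le_rfl

theorem mpow_mul_mpow (A : Matrix ι ι ℂ) (a b : ℝ) : mpow A a * mpow A b = mpow A (a + b) := by
  unfold mpow
  rw [← cfc_mul _ _ A (continuousOn_spectrum _ _) (continuousOn_spectrum _ _)]
  refine cfc_congr fun x _ => ?_
  by_cases h : 0 < x
  · simp [h, Real.rpow_add h]
  · simp [h]

theorem mpow_mpow (hA : A.IsHermitian) (a b : ℝ) : mpow (mpow A a) b = mpow A (a * b) := by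
  unfold mpow
  rw [← cfc_comp' _ _ A (continuousOn_image_spectrum _ _ _) (continuousOn_spectrum _ _)
    hA.isSelfAdjoint]
  refine cfc_congr fun x _ => ?_
  by_cases h : 0 < x
  · simp [h, Real.rpow_pos_of_pos h, Real.rpow_mul h.le]
  · simp [h]

theorem mpow_eq_rpow (hA : A.PosSemidef) {α : ℝ} (hα : 0 < α) : mpow A α = A ^ α := by
  rw [CFC.rpow_eq_cfc_real (ha := hA.nonneg)]
  refine cfc_congr fun x hx => ?_
  rcases (spectrum_nonneg hA hx).eq_or_lt with rfl | h
  · simp [Real.zero_rpow hα.ne']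
  · simp [h]

theorem mpow_one (hA : A.PosSemidef) : mpow A 1 = A := by
  rw [mpow_eq_rpow hA one_pos, CFC.rpow_one A hA.nonneg]

theorem mpow_zero (hA : A.PosDef) : mpow A 0 = 1 := by
  rw [mpow, ← cfc_one ℝ A hA.1.isSelfAdjoint]
  exact cfc_congr fun x hx => by simp [spectrum_pos hA hx]

theorem mpow_mul_mpow_neg (hA : A.PosDef) (α : ℝ) : mpow A α * mpow A (-α) = 1 := by
  rw [mpow_mul_mpow, add_neg_cancel, mpow_zero hA]

theorem mpow_neg_mul_mpow (hA : A.PosDef) (α : ℝ) : mpow A (-α) * mpow A α = 1 := by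
  rw [mpow_mul_mpow, neg_add_cancel, mpow_zero hA]

theorem mpow_neg_one (hA : A.PosDef) : mpow A (-1) = A⁻¹ := by
  have h := mpow_neg_mul_mpow hA 1
  rw [mpow_one hA.posSemidef] at h
  exact (inv_eq_left_inv h).symm

theorem mpow_posDef (hA : A.PosDef) (α : ℝ) : (mpow A α).PosDef :=
  (mpow_posSemidef A α).posDef_iff_isUnit.2 (IsUnit.of_mul_eq_one _ (mpow_mul_mpow_neg hA α))

theorem mpow_le_mpow (hA : A.PosSemidef) (hAB : A ≤ B) {α : ℝ} (h0 : 0 < α) (h1 : α ≤ 1) :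
    mpow A α ≤ mpow B α := by
  have hB : B.PosSemidef := Matrix.nonneg_iff_posSemidef.1 (hA.nonneg.trans hAB)
  rw [mpow_eq_rpow hA h0, mpow_eq_rpow hB h0]
  exact CFC.rpow_le_rpow ⟨h0.le, h1⟩ hAB

theorem mpow_smul (hA : A.PosSemidef) {c : ℝ} (hc : 0 < c) (α : ℝ) :
    mpow (c • A) α = (c ^ α) • mpow A α := by
  unfold mpow
  rw [← cfc_comp_smul c _ A (continuousOn_image_spectrum _ _ _) hA.1.isSelfAdjoint,
    ← cfc_smul _ _ A (continuousOn_spectrum _ _)]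
  refine cfc_congr fun x hx => ?_
  rcases (spectrum_nonneg hA hx).eq_or_lt with rfl | h
  · simp
  · simp [h, hc, Real.mul_rpow hc.le h.le]

theorem continuous_mpow {X : Type*} [TopologicalSpace X] {a : X → Matrix ι ι ℂ}
    (ha : Continuous a) (h : ∀ x, (a x).IsHermitian) {α : ℝ} (hα : 0 < α) :
    Continuous fun x => mpow (a x) α := by
  have hf : (fun x : ℝ => if 0 < x then x ^ α else 0) = fun x => max x 0 ^ α := by
    funext x
    split_ifs with hx
    · rw [max_eq_left hx.le]
    · rw [max_eq_right (not_lt.1 hx), Real.zero_rpow hα.ne']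
  have hf' : Continuous fun x : ℝ => if 0 < x then x ^ α else 0 :=
    hf ▸ (continuous_id.max continuous_const).rpow_const fun _ => Or.inr hα.le
  exact Continuous.cfc_of_mem_nhdsSet _ (s := Set.univ) univ_mem ha h hf'.continuousOn

theorem continuous_Qnew {X : Type*} [TopologicalSpace X] {a b : X → Matrix ι ι ℂ}
    (ha : Continuous a) (hb : Continuous b) (ha' : ∀ x, (a x).IsHermitian)
    (hb' : ∀ x, (b x).IsHermitian) {t : ℝ} (h0 : 0 < t) (h1 : t < 1) :
    Continuous fun x => Qnew t (a x) (b x) := by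
  have hK := continuous_mpow hb hb' (α := (1 - t) / (2 * t)) (div_pos (by linarith) (by linarith))
  refine continuous_rtr.comp (continuous_mpow ((hK.mul ha).mul hK) (fun x => ?_) h0)
  have h := isHermitian_mul_mul_conjTranspose (mpow (b x) ((1 - t) / (2 * t))) (ha' x)
  rwa [(mpow_isHermitian _ _).eq] at h

theorem rtr_mpow_conjTranspose_mul_self (C : Matrix ι ι ℂ) (α : ℝ) :
    rtr (mpow (Cᴴ * C) α) = rtr (mpow (C * Cᴴ) α) :=
  rtr_cfc_mul_comm (isHermitian_conjTranspose_mul_self C) (isHermitian_mul_conjTranspose_self C) _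

theorem rtr_mpow_nonneg (A : Matrix ι ι ℂ) (α : ℝ) : 0 ≤ rtr (mpow A α) :=
  rtr_nonneg (mpow_posSemidef A α)

theorem rtr_mpow (hA : A.PosSemidef) {α : ℝ} (hα : 0 < α) :
    rtr (mpow A α) = ∑ i, hA.1.eigenvalues i ^ α := by
  rw [mpow, rtr_cfc hA.1]
  refine Finset.sum_congr rfl fun i _ => ?_
  rcases (hA.eigenvalues_nonneg i).eq_or_lt with h | h
  · simp [← h, Real.zero_rpow hα.ne']
  · simp [h]

end Powers

section Perturbation

variable {ι : Type*} [DecidableEq ι] {A : Matrix ι ι ℂ}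

theorem add_smul_one_posDef (hA : A.PosSemidef) {ε : ℝ} (hε : 0 < ε) : (A + ε • 1).PosDef :=
  PosDef.posSemidef_add hA (PosDef.one.smul hε)

theorem add_smul_one_isHermitian (hA : A.IsHermitian) (ε : ℝ) : (A + ε • 1).IsHermitian :=
  hA.add (IsSelfAdjoint.smul (IsSelfAdjoint.all ε) isHermitian_one)

theorem continuous_add_smul_one (A : Matrix ι ι ℂ) : Continuous fun ε : ℝ => A + ε • 1 := by
  fun_prop

theorem le_of_forall_pos_le {f g : ℝ → ℝ} (hf : Continuous f) (hg : Continuous g)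
    (h : ∀ ε > 0, f ε ≤ g ε) : f 0 ≤ g 0 :=
  le_of_tendsto_of_tendsto ((hf.tendsto 0).mono_left (nhdsWithin_le_nhds (s := Set.Ioi 0)))
    ((hg.tendsto 0).mono_left nhdsWithin_le_nhds) (eventually_nhdsWithin_of_forall h)

end Perturbation

section TraceInequalities

variable {ι : Type*} [Fintype ι] [DecidableEq ι] {A B : Matrix ι ι ℂ}

theorem rtr_mpow_le_young (hA : A.PosSemidef) (hB : B.PosDef) {t : ℝ} (h0 : 0 < t) (h1 : t < 1) :
    rtr (mpow A t) ≤ t * rtr (A * B) + (1 - t) * rtr (mpow B (-(t / (1 - t)))) := by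
  have hs : 1 - t ≠ 0 := by linarith
  set x := hA.1.eigenvalues
  set y := hB.1.eigenvalues
  have hx (i : ι) : 0 ≤ x i := hA.eigenvalues_nonneg i
  have hy (j : ι) : 0 < y j := hB.eigenvalues_pos j
  have young (i j : ι) : x i ^ t ≤ t * (x i * y j) + (1 - t) * y j ^ (-(t / (1 - t))) := by
    have h := Real.geom_mean_le_arith_mean2_weighted h0.le (sub_nonneg.2 h1.le)
      (mul_nonneg (hx i) (hy j).le) (Real.rpow_nonneg (hy j).le (-(t / (1 - t)))) (by ring)
    rwa [Real.mul_rpow (hx i) (hy j).le, ← Real.rpow_mul (hy j).le, mul_assoc,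
      ← Real.rpow_add (hy j), neg_mul, div_mul_cancel₀ _ hs, add_neg_cancel, Real.rpow_zero,
      mul_one] at h
  have trace_pow : rtr (mpow A t) = ∑ i, ∑ j, x i ^ t * overlap hA.1 hB.1 i j := by
    simp_rw [rtr_mpow hA h0, ← Finset.mul_sum, sum_overlap_right, mul_one, x]
  have trace_mul : rtr (A * B) = ∑ i, ∑ j, x i * y j * overlap hA.1 hB.1 i j := by
    have h := rtr_cfc_mul_cfc hA.1 hB.1 id id
    rwa [cfc_id ℝ A hA.1.isSelfAdjoint, cfc_id ℝ B hB.1.isSelfAdjoint] at h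
  have trace_neg_pow : rtr (mpow B (-(t / (1 - t)))) =
      ∑ i, ∑ j, y j ^ (-(t / (1 - t))) * overlap hA.1 hB.1 i j := by
    rw [Finset.sum_comm, mpow, rtr_cfc hB.1]
    simp_rw [← Finset.mul_sum, sum_overlap_left, mul_one, if_pos (hB.eigenvalues_pos _), y]
  rw [trace_pow, trace_mul, trace_neg_pow]
  simp_rw [Finset.mul_sum, ← Finset.sum_add_distrib]
  refine Finset.sum_le_sum fun i _ => Finset.sum_le_sum fun j _ => ?_
  calc _ ≤ _ := mul_le_mul_of_nonneg_right (young i j) (overlap_nonneg hA.1 hB.1 i j)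
    _ = _ := by ring

theorem mpow_neg_le_mpow_neg (hA : A.PosDef) (hAB : A ≤ B) {α : ℝ} (h0 : 0 < α) (h1 : α ≤ 1) :
    mpow B (-α) ≤ mpow A (-α) := by
  have hB : B.PosDef := by
    simpa only [add_sub_cancel] using hA.add_posSemidef (Matrix.le_iff.1 hAB)
  let a : (Matrix ι ι ℂ)ˣ := ⟨mpow A α, mpow A (-α), mpow_mul_mpow_neg hA α, mpow_neg_mul_mpow hA α⟩
  let b : (Matrix ι ι ℂ)ˣ := ⟨mpow B α, mpow B (-α), mpow_mul_mpow_neg hB α, mpow_neg_mul_mpow hB α⟩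
  exact CStarAlgebra.inv_le_inv (a := a) (b := b) (mpow_posSemidef A α).nonneg
    (mpow_le_mpow hA.posSemidef hAB h0 h1)

theorem mul_mpow_sub_one (hA : A.PosSemidef) (α : ℝ) : A * mpow A (α - 1) = mpow A α := by
  conv_lhs => enter [1]; rw [← mpow_one hA]
  rw [mpow_mul_mpow, add_sub_cancel]

theorem rtr_mul_mpow_sub_one_le (hA : A.PosDef) (hAB : A ≤ B) {t : ℝ} (h0 : 0 ≤ t)
    (h1 : t < 1) : rtr (A * mpow B (t - 1)) ≤ rtr (mpow A t) := by
  have h := mpow_neg_le_mpow_neg hA hAB (sub_pos.2 h1) (sub_le_self 1 h0)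
  rw [neg_sub] at h
  exact (rtr_mul_le_rtr_mul hA.posSemidef h).trans_eq (by rw [mul_mpow_sub_one hA.posSemidef])

theorem rtr_mpow_add_le_of_posDef (hA : A.PosDef) (hB : B.PosDef) {t : ℝ} (h0 : 0 ≤ t)
    (h1 : t < 1) : rtr (mpow (A + B) t) ≤ rtr (mpow A t) + rtr (mpow B t) := by
  rw [← mul_mpow_sub_one (hA.add hB).posSemidef, add_mul, rtr_add]
  exact add_le_add
    (rtr_mul_mpow_sub_one_le hA (le_add_of_nonneg_right hB.posSemidef.nonneg) h0 h1)
    (rtr_mul_mpow_sub_one_le hB (le_add_of_nonneg_left hA.posSemidef.nonneg) h0 h1)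

theorem rtr_mpow_add_le (hA : A.PosSemidef) (hB : B.PosSemidef) {t : ℝ} (h0 : 0 < t)
    (h1 : t < 1) : rtr (mpow (A + B) t) ≤ rtr (mpow A t) + rtr (mpow B t) := by
  have hcA := continuous_add_smul_one A
  have hcB := continuous_add_smul_one B
  have hA' := add_smul_one_isHermitian hA.1
  have hB' := add_smul_one_isHermitian hB.1
  have h := le_of_forall_pos_le
    (continuous_rtr.comp (continuous_mpow (hcA.add hcB) (fun ε => (hA' ε).add (hB' ε)) h0))
    ((continuous_rtr.comp (continuous_mpow hcA hA' h0)).add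
      (continuous_rtr.comp (continuous_mpow hcB hB' h0)))
    (fun ε hε => rtr_mpow_add_le_of_posDef (add_smul_one_posDef hA hε)
      (add_smul_one_posDef hB hε) h0.le h1)
  simpa using h

theorem re_diag_mul_mpow_mul_le {G M : Matrix ι ι ℂ} (hG : G.PosSemidef) {i : ι}
    (hM : ((M * Mᴴ) i i).re ≤ 1) {s : ℝ} (h0 : 0 < s) (h1 : s ≤ 1) :
    ((M * mpow G s * Mᴴ) i i).re ≤ ((M * G * Mᴴ) i i).re ^ s := by
  set w := fun j => ‖(M * (hG.1.eigenvectorUnitary : Matrix ι ι ℂ)) i j‖ ^ 2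
  set x := hG.1.eigenvalues
  have hx (j : ι) : 0 ≤ x j := hG.eigenvalues_nonneg j
  have diag_pow : ((M * mpow G s * Mᴴ) i i).re = ∑ j, w j * x j ^ s := by
    rw [mpow, diag_mul_cfc_mul hG.1]
    refine Finset.sum_congr rfl fun j _ => ?_
    rcases (hx j).eq_or_lt with h | h
    · simp [x, ← h, Real.zero_rpow h0.ne']
    · rw [if_pos h, mul_comm]
  have diag : ((M * G * Mᴴ) i i).re = ∑ j, w j * x j := by
    have h := diag_mul_cfc_mul hG.1 id M i
    rw [cfc_id ℝ G hG.1.isSelfAdjoint] at h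
    exact h.trans (Finset.sum_congr rfl fun j _ => mul_comm _ _)
  have sum_weights : ∑ j, w j ≤ 1 := by
    have h := diag_mul_cfc_mul hG.1 (fun _ => 1) M i
    rw [cfc_const_one ℝ G hG.1.isSelfAdjoint, mul_one] at h
    simpa [h] using hM
  have jensen := Real.inner_le_weight_mul_Lp_of_nonneg Finset.univ (p := s⁻¹)
    ((one_le_inv₀ h0).2 h1) w (fun j => x j ^ s) (fun j => sq_nonneg _)
    (fun j => Real.rpow_nonneg (hx j) s)
  simp_rw [← Real.rpow_mul (hx _), mul_inv_cancel₀ h0.ne', Real.rpow_one, inv_inv] at jensen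
  rw [diag_pow, diag]
  refine jensen.trans (mul_le_of_le_one_left ?_ ?_)
  · exact Real.rpow_nonneg (Finset.sum_nonneg fun j _ => mul_nonneg (sq_nonneg _) (hx j)) s
  · exact Real.rpow_le_one (Finset.sum_nonneg fun j _ => sq_nonneg _) sum_weights (by linarith)

theorem rtr_conj_mpow_le {C G : Matrix ι ι ℂ} (hG : G.PosSemidef) (hC : Cᴴ * C ≤ 1) {s : ℝ}
    (h0 : 0 < s) (h1 : s ≤ 1) : rtr (Cᴴ * mpow G s * C) ≤ rtr (mpow (Cᴴ * G * C) s) := by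
  have hH : (Cᴴ * G * C).PosSemidef := hG.conjTranspose_mul_mul_same C
  set U := (hH.1.eigenvectorUnitary : Matrix ι ι ℂ)
  have hconj (N : Matrix ι ι ℂ) : Uᴴ * Cᴴ * N * (Uᴴ * Cᴴ)ᴴ = Uᴴ * (Cᴴ * N * C) * U := by
    simp only [conjTranspose_mul, conjTranspose_conjTranspose, mul_assoc]
  have trace_eq : rtr (Cᴴ * mpow G s * C) =
      ∑ i, ((Uᴴ * Cᴴ * mpow G s * (Uᴴ * Cᴴ)ᴴ) i i).re := by
    have h := rtr_cfc_mul hH.1 (fun _ => 1) (Cᴴ * mpow G s * C)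
    rw [cfc_const_one ℝ _ hH.1.isSelfAdjoint, one_mul] at h
    simp_rw [h, hconj, one_mul, U]
  have eigenvalue_eq (i : ι) :
      ((Uᴴ * Cᴴ * G * (Uᴴ * Cᴴ)ᴴ) i i).re = hH.1.eigenvalues i := by
    have h := hH.1.conjStarAlgAut_star_eigenvectorUnitary
    rw [Unitary.conjStarAlgAut_star_apply] at h
    have h := congrArg Complex.re (congrFun₂ h i i)
    rw [diagonal_apply_eq] at h
    rw [hconj]
    exact h
  have row_le_one (i : ι) : ((Uᴴ * Cᴴ * (Uᴴ * Cᴴ)ᴴ) i i).re ≤ 1 := by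
    have hU : Uᴴ * U = 1 := Unitary.coe_star_mul_self hH.1.eigenvectorUnitary
    have h := ((Matrix.le_iff.1 hC).conjTranspose_mul_mul_same U).diag_nonneg (i := i)
    have hconj_one := hconj 1
    rw [mul_one, mul_one] at hconj_one
    rw [mul_sub, sub_mul, mul_one, hU, ← hconj_one, Matrix.sub_apply, one_apply_eq] at h
    exact sub_nonneg.1 (Complex.le_def.1 h).1
  rw [trace_eq, rtr_mpow hH h0]
  exact Finset.sum_le_sum fun i _ =>
    (re_diag_mul_mpow_mul_le hG (row_le_one i) h0 h1).trans_eq (by rw [eigenvalue_eq])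

end TraceInequalities

section SandwichedQuantity

variable {ι : Type*} [Fintype ι] [DecidableEq ι] {A B : Matrix ι ι ℂ}

theorem Qnew_nonneg (t : ℝ) (A B : Matrix ι ι ℂ) : 0 ≤ Qnew t A B :=
  rtr_mpow_nonneg _ _

theorem Qnew_smul (hA : A.PosSemidef) {c : ℝ} (hc : 0 < c) (t : ℝ) :
    Qnew t (c • A) B = c ^ t * Qnew t A B := by
  rw [Qnew, mul_smul_comm, smul_mul_assoc,
    mpow_smul (conj_posSemidef (mpow_isHermitian _ _) hA) hc, rtr_smul, Qnew]

theorem Qnew_le_add_of_posDef (hA : A.PosSemidef) (hB : B.PosDef) {t : ℝ} (h0 : 0 < t)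
    (h1 : t < 1) : Qnew t A B ≤ t * rtr A + (1 - t) * rtr B := by
  have hs : 1 - t ≠ 0 := by linarith
  set κ := (1 - t) / (2 * t) with hκ
  have young := rtr_mpow_le_young (conj_posSemidef (mpow_isHermitian B κ) hA)
    (mpow_posDef hB (-(2 * κ))) h0 h1
  have hcancel : rtr (mpow B κ * A * mpow B κ * mpow B (-(2 * κ))) = rtr A := by
    rw [mul_assoc, mul_assoc, rtr_mul_comm, mul_assoc, mul_assoc, mpow_mul_mpow, mpow_mul_mpow,
      show κ + (-(2 * κ) + κ) = 0 by ring, mpow_zero hB, mul_one]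
  rwa [hcancel, mpow_mpow hB.1, show -(2 * κ) * -(t / (1 - t)) = 1 by rw [hκ]; field_simp,
    mpow_one hB.posSemidef] at young

theorem Qnew_le_add (hA : A.PosSemidef) (hB : B.PosSemidef) {t : ℝ} (h0 : 0 < t) (h1 : t < 1) :
    Qnew t A B ≤ t * rtr A + (1 - t) * rtr B := by
  have hc := continuous_add_smul_one B
  have h := le_of_forall_pos_le
    (continuous_Qnew continuous_const hc (fun _ => hA.1) (add_smul_one_isHermitian hB.1) h0 h1)
    (continuous_const.add (continuous_const.mul (continuous_rtr.comp hc)))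
    (fun ε hε => Qnew_le_add_of_posDef hA (add_smul_one_posDef hB hε) h0 h1)
  simpa using h

theorem Qnew_le_rpow_mul_rpow (hA : A.PosSemidef) (hB : B.PosSemidef) {t : ℝ} (h0 : 0 < t)
    (h1 : t < 1) {u v : ℝ} (hu : 0 < u) (hv : 0 < v) (hAu : rtr A ≤ u) (hBv : rtr B ≤ v) :
    Qnew t A B ≤ u ^ t * v ^ (1 - t) := by
  have hc : 0 < v / u := div_pos hv hu
  have hscaled : (v / u) ^ t * Qnew t A B ≤ v := by
    rw [← Qnew_smul hA hc]
    calc Qnew t ((v / u) • A) B ≤ t * (v / u * rtr A) + (1 - t) * rtr B := by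
          simpa only [rtr_smul] using Qnew_le_add (hA.smul hc.le) hB h0 h1
      _ ≤ t * (v / u * u) + (1 - t) * v := by gcongr
      _ = v := by rw [div_mul_cancel₀ _ hu.ne']; ring
  have hfactor : u ^ t * v ^ (1 - t) = v / (v / u) ^ t := by
    rw [Real.div_rpow hv.le hu.le, Real.rpow_sub hv, Real.rpow_one, div_div_eq_mul_div]
    ring
  rwa [hfactor, le_div_iff₀' (Real.rpow_pos_of_pos hc t)]

theorem Qnew_sum_le {κ : Type*} (s : Finset κ) {ρ : κ → Matrix ι ι ℂ}
    (hρ : ∀ i ∈ s, (ρ i).PosSemidef) {t : ℝ} (h0 : 0 < t) (h1 : t < 1) :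
    Qnew t (∑ i ∈ s, ρ i) B ≤ ∑ i ∈ s, Qnew t (ρ i) B := by
  classical
  induction s using Finset.induction_on with
  | empty => simp [Qnew, mpow, rtr, cfc_apply_zero]
  | insert a s ha ih =>
    have hs : ∀ i ∈ s, (ρ i).PosSemidef := fun i hi => hρ i (Finset.mem_insert_of_mem hi)
    rw [Finset.sum_insert ha, Finset.sum_insert ha]
    refine le_trans ?_ (add_le_add le_rfl (ih hs))
    rw [Qnew, mul_add, add_mul]
    exact rtr_mpow_add_le
      (conj_posSemidef (mpow_isHermitian _ _) (hρ a (Finset.mem_insert_self _ _)))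
      (conj_posSemidef (mpow_isHermitian _ _) (posSemidef_sum s hs)) h0 h1

end SandwichedQuantity

section NeymanPearson

variable {ι : Type*} [Fintype ι] [DecidableEq ι] {A B T : Matrix ι ι ℂ}

/-- The total error `Tr A(1 - T) + Tr BT` of the test `T` discriminating between the unnormalised
states `A` and `B`. -/
def errorSum (A B T : Matrix ι ι ℂ) : ℝ :=
  rtr (A * (1 - T)) + rtr (B * T)

theorem errorSum_eq (A B T : Matrix ι ι ℂ) : errorSum A B T = rtr A - rtr (T * (A - B)) := by
  rw [errorSum, rtr_mul_comm T, mul_sub, sub_mul, rtr_sub, rtr_sub, mul_one]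
  ring

theorem continuous_errorSum {X : Type*} [TopologicalSpace X] {a b : X → Matrix ι ι ℂ}
    (ha : Continuous a) (hb : Continuous b) (T : Matrix ι ι ℂ) :
    Continuous fun x => errorSum (a x) (b x) T :=
  (continuous_rtr.comp (ha.mul continuous_const)).add
    (continuous_rtr.comp (hb.mul continuous_const))

theorem one_sub_cfc (hA : A.IsHermitian) (f : ℝ → ℝ) :
    1 - cfc f A = cfc (fun x => 1 - f x) A := by
  rw [cfc_sub _ _ A (continuousOn_spectrum _ _) (continuousOn_spectrum _ _),
    cfc_const_one ℝ A hA.isSelfAdjoint]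

theorem posProj_isTest (hA : A.IsHermitian) : IsTest (posProj A) := by
  refine ⟨Matrix.nonneg_iff_posSemidef.1 (cfc_nonneg fun x _ => ?_), ?_⟩
  · split_ifs <;> norm_num
  · rw [posProj, one_sub_cfc hA]
    exact Matrix.nonneg_iff_posSemidef.1 (cfc_nonneg fun x _ => by split_ifs <;> norm_num)

theorem posProj_mul_posProj (A : Matrix ι ι ℂ) : posProj A * posProj A = posProj A := by
  rw [posProj, ← cfc_mul _ _ A (continuousOn_spectrum _ _) (continuousOn_spectrum _ _)]
  exact cfc_congr fun x _ => by simp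

theorem posProj_mul_self (hA : A.IsHermitian) : posProj A * A = A⁺ := by
  conv_lhs => enter [2]; rw [← cfc_id ℝ A hA.isSelfAdjoint]
  rw [posProj, ← cfc_mul _ _ A (continuousOn_spectrum _ _) (continuousOn_spectrum _ _),
    CFC.posPart_def, cfcₙ_eq_cfc]
  refine cfc_congr fun x _ => ?_
  by_cases h : 0 < x
  · simp [h, h.le]
  · simp [h, not_lt.1 h]

theorem errorSum_posProj (hA : A.IsHermitian) (hB : B.IsHermitian) :
    errorSum A B (posProj (A - B)) = rtr A - rtr (A - B)⁺ := by
  rw [errorSum_eq, posProj_mul_self (hA.sub hB)]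

theorem errorSum_posProj_le (hA : A.IsHermitian) (hB : B.IsHermitian) (hT : IsTest T) :
    errorSum A B (posProj (A - B)) ≤ errorSum A B T := by
  have hle : A - B ≤ (A - B)⁺ := CFC.le_posPart (hA.sub hB).isSelfAdjoint
  have hpos : (A - B)⁺.PosSemidef := Matrix.nonneg_iff_posSemidef.1 (CFC.posPart_nonneg _)
  rw [errorSum_posProj hA hB, errorSum_eq]
  refine sub_le_sub_left ?_ _
  calc rtr (T * (A - B)) ≤ rtr (T * (A - B)⁺) := rtr_mul_le_rtr_mul hT.1 hle
    _ = rtr ((A - B)⁺ * T) := rtr_mul_comm _ _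
    _ ≤ rtr ((A - B)⁺ * 1) := rtr_mul_le_rtr_mul hpos (Matrix.le_iff.2 hT.2)
    _ = rtr (A - B)⁺ := by rw [mul_one]

/-- Audenaert's inequality: `A` and `B` have the common upper bound `C = B + (A - B)⁺`, whose powers
may be compared with theirs by operator monotonicity. -/
theorem errorSum_posProj_le_Qold (hA : A.PosSemidef) (hB : B.PosSemidef) {t : ℝ} (h0 : 0 < t)
    (h1 : t < 1) : errorSum A B (posProj (A - B)) ≤ Qold t A B := by
  have hle : A - B ≤ (A - B)⁺ := CFC.le_posPart (hA.1.sub hB.1).isSelfAdjoint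
  have hpos : 0 ≤ (A - B)⁺ := CFC.posPart_nonneg _
  set C := B + (A - B)⁺ with hC
  have hAC : A ≤ C := by simpa only [add_sub_cancel] using add_le_add_right hle B
  have hBC : B ≤ C := le_add_of_nonneg_right hpos
  have hCp : C.PosSemidef := Matrix.nonneg_iff_posSemidef.1 (hB.nonneg.trans hBC)
  have h0' : 0 < 1 - t := by linarith
  have h1' : 1 - t ≤ 1 := by linarith
  have hBCt : (mpow C (1 - t) - mpow B (1 - t)).PosSemidef :=
    Matrix.le_iff.1 (mpow_le_mpow hB hBC h0' h1')
  have split {M : Matrix ι ι ℂ} (hM : M.PosSemidef) : rtr (mpow M t * mpow M (1 - t)) = rtr M := by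
    rw [mpow_mul_mpow, add_sub_cancel, mpow_one hM]
  have upper : rtr A ≤ rtr (A - B)⁺ + Qold t A B := by
    calc rtr A = rtr (mpow A t * mpow A (1 - t)) := (split hA).symm
      _ ≤ rtr (mpow A t * mpow C (1 - t)) :=
        rtr_mul_le_rtr_mul (mpow_posSemidef A t) (mpow_le_mpow hA hAC h0' h1')
      _ = rtr ((mpow C (1 - t) - mpow B (1 - t)) * mpow A t) + Qold t A B := by
        rw [rtr_mul_comm _ (mpow A t), mul_sub, rtr_sub, Qold, sub_add_cancel]
      _ ≤ rtr ((mpow C (1 - t) - mpow B (1 - t)) * mpow C t) + Qold t A B := by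
        gcongr
        exact rtr_mul_le_rtr_mul hBCt (mpow_le_mpow hA hAC h0 h1.le)
      _ = rtr C - rtr (mpow B (1 - t) * mpow C t) + Qold t A B := by
        rw [sub_mul, rtr_sub, rtr_mul_comm _ (mpow C t), split hCp]
      _ ≤ rtr C - rtr (mpow B (1 - t) * mpow B t) + Qold t A B := by
        gcongr
        exact rtr_mul_le_rtr_mul (mpow_posSemidef B _) (mpow_le_mpow hB hBC h0 h1.le)
      _ = rtr (A - B)⁺ + Qold t A B := by
        rw [rtr_mul_comm, split hB, hC, rtr_add, add_sub_cancel_left]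
  rw [errorSum_posProj hA.1 hB.1]
  linarith

end NeymanPearson

section SmallExponents

variable {ι : Type*} [Fintype ι] [DecidableEq ι] {A B G K W : Matrix ι ι ℂ}

theorem posProj_one_sub (hW : W.IsHermitian) :
    posProj (1 - W) = cfc (fun x : ℝ => if x < 1 then 1 else 0) W := by
  have h : 1 - W = cfc (fun x : ℝ => 1 - x) W := by
    conv_lhs => enter [2]; rw [← cfc_id ℝ W hW.isSelfAdjoint]
    exact one_sub_cfc hW _
  rw [posProj, h, ← cfc_comp' _ _ W (continuousOn_image_spectrum _ _ _)
    (continuousOn_spectrum _ _) hW.isSelfAdjoint]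
  simp only [sub_pos]

theorem one_sub_posProj_one_sub_le (hW : W.PosSemidef) : 1 - posProj (1 - W) ≤ W := by
  rw [posProj_one_sub hW.1, one_sub_cfc hW.1]
  conv_rhs => rw [← cfc_id ℝ W hW.1.isSelfAdjoint]
  refine cfc_mono (fun x hx => ?_) (continuousOn_spectrum _ _) (continuousOn_spectrum _ _)
  split_ifs with h
  · simpa using spectrum_nonneg hW hx
  · simpa using h

theorem posProj_one_sub_le_inv (hW : W.PosDef) : posProj (1 - W) ≤ W⁻¹ := by
  rw [posProj_one_sub hW.1, ← mpow_neg_one hW]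
  refine cfc_mono (fun x hx => ?_) (continuousOn_spectrum _ _) (continuousOn_spectrum _ _)
  have hx := spectrum_pos hW hx
  rw [if_pos hx, Real.rpow_neg_one]
  split_ifs with h
  · exact (one_le_inv₀ hx).2 h.le
  · exact (inv_pos.2 hx).le

theorem conj_posProj_one_sub_conj_le_inv (hK : K.PosDef) (hG : G.PosDef) :
    K * posProj (1 - K * G * K) * K ≤ G⁻¹ := by
  have hdet : IsUnit K.det := (isUnit_iff_isUnit_det K).1 hK.isUnit
  refine (conj_mono hK.1 (posProj_one_sub_le_inv (conj_posDef hK hG))).trans_eq ?_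
  rw [Matrix.mul_inv_rev, Matrix.mul_inv_rev, ← mul_assoc, mul_nonsing_inv K hdet, one_mul,
    mul_assoc, nonsing_inv_mul K hdet, mul_one]

theorem rtr_mpow_mul_posProj_le (hK : K.PosDef) (hG : G.PosDef) {s : ℝ} (h0 : 0 < s)
    (h1 : s ≤ 1) : rtr (mpow (K * K) s * posProj (1 - K * G * K)) ≤ rtr (mpow G (-s)) := by
  set P := posProj (1 - K * G * K)
  have hP : IsTest P := posProj_isTest (isHermitian_one.sub (conj_posDef hK hG).1)
  have hPP : P * P = P := posProj_mul_posProj _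
  have hPh : Pᴴ = P := hP.1.1
  have hKK : (K * K).PosSemidef := by
    simpa only [hK.1.eq] using posSemidef_conjTranspose_mul_self K
  calc rtr (mpow (K * K) s * P) = rtr (Pᴴ * mpow (K * K) s * P) := by
        rw [hPh, rtr_mul_comm (P * _), ← mul_assoc, hPP, rtr_mul_comm]
    _ ≤ rtr (mpow (Pᴴ * (K * K) * P) s) :=
        rtr_conj_mpow_le hKK (by rw [hPh, hPP]; exact Matrix.le_iff.2 hP.2) h0 h1
    _ = rtr (mpow (K * P * K) s) := by
        have h := rtr_mpow_conjTranspose_mul_self (K * P) s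
        rw [conjTranspose_mul, hPh, hK.1.eq] at h
        rw [hPh, show P * (K * K) * P = P * K * (K * P) by simp only [mul_assoc], h,
          show K * P * (P * K) = K * (P * P) * K by simp only [mul_assoc], hPP]
    _ ≤ rtr (mpow G⁻¹ s) := rtr_mono (mpow_le_mpow (conj_posSemidef hK.1 hP.1)
        (conj_posProj_one_sub_conj_le_inv hK hG) h0 h1)
    _ = rtr (mpow G (-s)) := by rw [← mpow_neg_one hG, mpow_mpow hG.1, neg_one_mul]

/-- With `K = B ^ ((1 - t) / (2t))` and `X = K A K`, both errors of the test `{K X ^ (t - 1) K < 1}`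
are at most `Tr X ^ t`. -/
theorem exists_isTest_errorSum_le_two_mul_Qnew (hA : A.PosDef) (hB : B.PosDef) {t : ℝ}
    (h0 : 0 < t) (h1 : t ≤ 1 / 2) : ∃ T, IsTest T ∧ errorSum A B T ≤ 2 * Qnew t A B := by
  have ht : 0 < 1 - t := by linarith
  set κ := (1 - t) / (2 * t) with hκ
  set K := mpow B κ with hK
  set X := K * A * K with hX
  have hKd : K.PosDef := mpow_posDef hB _
  have hXd : X.PosDef := conj_posDef hKd hA
  have hGd : (mpow X (t - 1)).PosDef := mpow_posDef hXd _
  have hWd := conj_posDef hKd hGd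
  have first_error : rtr (A * (1 - posProj (1 - K * mpow X (t - 1) * K))) ≤ Qnew t A B := by
    calc _ ≤ rtr (A * (K * mpow X (t - 1) * K)) :=
          rtr_mul_le_rtr_mul hA.posSemidef (one_sub_posProj_one_sub_le hWd.posSemidef)
      _ = rtr (X * mpow X (t - 1)) := by
          rw [← mul_assoc, rtr_mul_comm, hX]
          simp only [mul_assoc]
      _ = Qnew t A B := by rw [mul_mpow_sub_one hXd.posSemidef, Qnew]
  have second_error : rtr (B * posProj (1 - K * mpow X (t - 1) * K)) ≤ Qnew t A B := by
    have hBK : mpow (K * K) (t / (1 - t)) = B := by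
      rw [hK, mpow_mul_mpow, mpow_mpow hB.1, ← two_mul, hκ,
        show 2 * ((1 - t) / (2 * t)) * (t / (1 - t)) = 1 by field_simp, mpow_one hB.posSemidef]
    have h := rtr_mpow_mul_posProj_le hKd hGd (div_pos h0 ht) ((div_le_one ht).2 (by linarith))
    rwa [hBK, mpow_mpow hXd.1, show (t - 1) * -(t / (1 - t)) = t by field_simp; ring] at h
  exact ⟨_, posProj_isTest (isHermitian_one.sub hWd.1),
    (add_le_add first_error second_error).trans_eq (two_mul _).symm⟩

end SmallExponents

section CPow

variable {ι : Type*} [Fintype ι] [DecidableEq ι] {A : Matrix ι ι ℂ}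

/-- The complex power `A ^ z = exp (z log A)` of a positive definite operator, used to interpolate
between real powers along vertical lines. -/
noncomputable def cpow (A : Matrix ι ι ℂ) (z : ℂ) : Matrix ι ι ℂ :=
  NormedSpace.exp (z • CFC.log A)

theorem cpow_add (A : Matrix ι ι ℂ) (z w : ℂ) : cpow A (z + w) = cpow A z * cpow A w := by
  rw [cpow, add_smul, Matrix.exp_add_of_commute _ _
    (((Commute.refl (CFC.log A)).smul_left z).smul_right w), cpow, cpow]

theorem cpow_ofReal (hA : A.PosDef) (s : ℝ) : cpow A s = mpow A s := by
  have hlog : ContinuousOn (fun x => s * Real.log x) (spectrum ℝ A) := continuousOn_spectrum _ _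
  have hsmul : (s : ℂ) • CFC.log A = cfc (fun x => s * Real.log x) A := by
    rw [cfc_const_mul s Real.log A (continuousOn_spectrum _ _), CFC.log, Complex.coe_smul]
  rw [cpow, hsmul, ← CFC.real_exp_eq_normedSpace_exp (cfc_predicate _ A),
    ← cfc_comp' Real.exp _ A Real.continuous_exp.continuousOn hlog hA.1.isSelfAdjoint, mpow]
  refine cfc_congr fun x hx => ?_
  have hx := spectrum_pos hA hx
  rw [if_pos hx, Real.rpow_def_of_pos hx, mul_comm]

theorem cpow_ofReal_mul_I_mem_unitary (A : Matrix ι ι ℂ) (y : ℝ) :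
    cpow A (y * Complex.I) ∈ unitary (Matrix ι ι ℂ) := by
  have hlog : IsSelfAdjoint (y • CFC.log A) := (IsSelfAdjoint.all y).smul IsSelfAdjoint.log
  have h : cpow A (y * Complex.I) = selfAdjoint.expUnitary ⟨y • CFC.log A, hlog⟩ := by
    rw [selfAdjoint.expUnitary_coe, cpow, mul_comm, mul_smul, Complex.coe_smul]
  exact h ▸ SetLike.coe_mem _

theorem differentiable_cpow (A : Matrix ι ι ℂ) : Differentiable ℂ (cpow A) :=
  fun z => (hasDerivAt_exp_smul_const (CFC.log A) z).differentiableAt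

theorem norm_le_one_of_mem_unitary {V : Matrix ι ι ℂ} (hV : V ∈ unitary (Matrix ι ι ℂ)) :
    ‖V‖ ≤ 1 := by
  nontriviality Matrix ι ι ℂ
  exact (CStarRing.norm_of_mem_unitary hV).le

theorem norm_cpow_le_norm_cpow_re (A : Matrix ι ι ℂ) (z : ℂ) : ‖cpow A z‖ ≤ ‖cpow A z.re‖ := by
  conv_lhs => rw [← Complex.re_add_im z, cpow_add]
  exact (norm_mul_le _ _).trans
    (mul_le_of_le_one_right (norm_nonneg _)
      (norm_le_one_of_mem_unitary (cpow_ofReal_mul_I_mem_unitary A _)))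

end CPow

section ArakiLiebThirring

variable {ι : Type*} [Fintype ι] [DecidableEq ι] {A B K : Matrix ι ι ℂ}

theorem trace_cfc_mul_mul_cfc_mul (hA : A.IsHermitian) (f g : ℝ → ℝ) (V W : Matrix ι ι ℂ) :
    (cfc f A * V * cfc g A * W).trace = ∑ i, ∑ j,
      (f (hA.eigenvalues i) : ℂ) * g (hA.eigenvalues j) *
      (((hA.eigenvectorUnitary : Matrix ι ι ℂ)ᴴ * V * hA.eigenvectorUnitary) i j *
        ((hA.eigenvectorUnitary : Matrix ι ι ℂ)ᴴ * W * hA.eigenvectorUnitary) j i) := by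
  set E := (hA.eigenvectorUnitary : Matrix ι ι ℂ)
  have h : cfc f A * V * cfc g A * W = E * (diagonal (fun i => ((f (hA.eigenvalues i) : ℝ) : ℂ)) *
      (Eᴴ * V * E) * diagonal (fun i => ((g (hA.eigenvalues i) : ℝ) : ℂ)) * (Eᴴ * W)) := by
    simp only [cfc_eq_mul_diagonal_mul hA, mul_assoc, E]
  rw [h, trace_mul_comm, mul_assoc _ (Eᴴ * W), trace]
  refine Finset.sum_congr rfl fun i _ => ?_
  rw [diag_apply, mul_apply]
  refine Finset.sum_congr rfl fun j _ => ?_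
  rw [mul_diagonal, diagonal_mul]
  ring

theorem rpow_mul_rpow_le_weighted_add {x y a b : ℝ} (hx : 0 ≤ x) (hy : 0 ≤ y) (ha : 0 ≤ a)
    (hb : 0 ≤ b) (hab : 0 < a + b) :
    x ^ a * y ^ b ≤ a / (a + b) * x ^ (a + b) + b / (a + b) * y ^ (a + b) := by
  have := Real.geom_mean_le_arith_mean2_weighted (div_nonneg ha hab.le) (div_nonneg hb hab.le)
    (Real.rpow_nonneg hx (a + b)) (Real.rpow_nonneg hy (a + b)) (by field_simp)
  rwa [← Real.rpow_mul hx, ← Real.rpow_mul hy, mul_div_cancel₀ _ hab.ne',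
    mul_div_cancel₀ _ hab.ne'] at this

theorem norm_trace_mpow_mul_mul_mpow_mul_le (hA : A.PosDef) {V W : Matrix ι ι ℂ}
    (hV : V ∈ unitary (Matrix ι ι ℂ)) (hW : W ∈ unitary (Matrix ι ι ℂ)) {a b : ℝ}
    (ha : 0 ≤ a) (hb : 0 ≤ b) (hab : 0 < a + b) :
    ‖(mpow A a * V * mpow A b * W).trace‖ ≤ rtr (mpow A (a + b)) := by
  set x := hA.1.eigenvalues
  set c := a + b
  have hx : ∀ i, 0 < x i := hA.eigenvalues_pos
  set E := hA.1.eigenvectorUnitary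
  set P := (E : Matrix ι ι ℂ)ᴴ * V * E
  set Q := (E : Matrix ι ι ℂ)ᴴ * W * E
  have hP : P ∈ unitary (Matrix ι ι ℂ) := mul_mem (mul_mem (Unitary.star_mem E.2) hV) E.2
  have hQ : Q ∈ unitary (Matrix ι ι ℂ) := mul_mem (mul_mem (Unitary.star_mem E.2) hW) E.2
  have young (i j : ι) : x i ^ a * x j ^ b ≤ a / c * x i ^ c + b / c * x j ^ c :=
    rpow_mul_rpow_le_weighted_add (hx i).le (hx j).le ha hb hab
  have mean (i j : ι) : ‖P i j * Q j i‖ ≤ (‖P i j‖ ^ 2 + ‖Q j i‖ ^ 2) / 2 := by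
    rw [norm_mul]
    linarith [two_mul_le_add_sq ‖P i j‖ ‖Q j i‖]
  have row (i : ι) : ∑ j, (‖P i j‖ ^ 2 + ‖Q j i‖ ^ 2) / 2 = 1 := by
    rw [← Finset.sum_div, Finset.sum_add_distrib, sum_norm_sq_row hP, sum_norm_sq_col hQ]
    norm_num
  have col (j : ι) : ∑ i, (‖P i j‖ ^ 2 + ‖Q j i‖ ^ 2) / 2 = 1 := by
    rw [← Finset.sum_div, Finset.sum_add_distrib, sum_norm_sq_col hP, sum_norm_sq_row hQ]
    norm_num
  rw [mpow, mpow, trace_cfc_mul_mul_cfc_mul hA.1]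
  calc _ ≤ ∑ i, ∑ j, (a / c * x i ^ c + b / c * x j ^ c) * ((‖P i j‖ ^ 2 + ‖Q j i‖ ^ 2) / 2) := by
        refine (norm_sum_le _ _).trans (Finset.sum_le_sum fun i _ => (norm_sum_le _ _).trans
          (Finset.sum_le_sum fun j _ => ?_))
        rw [norm_mul, if_pos (hx i), if_pos (hx j), ← Complex.ofReal_mul, Complex.norm_of_nonneg
          (mul_nonneg (Real.rpow_nonneg (hx i).le _) (Real.rpow_nonneg (hx j).le _))]
        exact mul_le_mul (young i j) (mean i j) (norm_nonneg _) ((mul_nonneg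
          (Real.rpow_nonneg (hx i).le _) (Real.rpow_nonneg (hx j).le _)).trans (young i j))
    _ = a / c * ∑ i, x i ^ c + b / c * ∑ j, x j ^ c := by
        simp_rw [add_mul, Finset.sum_add_distrib]
        congr 1
        · simp_rw [← Finset.mul_sum, row, mul_one, ← Finset.mul_sum]
        · rw [Finset.sum_comm]
          simp_rw [← Finset.mul_sum, col, mul_one, ← Finset.mul_sum]
    _ = rtr (mpow A c) := by
        rw [rtr_mpow hA.posSemidef hab, ← add_mul, ← add_div, div_self hab.ne', one_mul]

/-- The entire function `Tr K A^z K^(2z-1) X^(t-z)`, `X = K A K`, interpolating the two sides of the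
Araki–Lieb–Thirring inequality. At `z = t` it is `Tr A^t K^(2t)`; on the lines `Re z = 1/2` and
`Re z = 1` the polar decomposition `A^(1/2) K = U X^(1/2)` turns it into a trace of powers of `X`
and unitaries. -/
noncomputable def interp (A K : Matrix ι ι ℂ) (t : ℝ) (z : ℂ) : ℂ :=
  (K * cpow A z * cpow K (2 * z - 1) * cpow (K * A * K) (t - z)).trace

theorem differentiable_interp (A K : Matrix ι ι ℂ) (t : ℝ) : Differentiable ℂ (interp A K t) := by
  have h (M : Matrix ι ι ℂ) {f : ℂ → ℂ} (hf : Differentiable ℂ f) :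
      Differentiable ℂ fun z => cpow M (f z) := (differentiable_cpow M).comp hf
  exact (LinearMap.toContinuousLinearMap (traceLinearMap ι ℂ ℂ)).differentiable.comp
    ((((h A differentiable_id).const_mul K).mul (h K (by fun_prop))).mul
      (h (K * A * K) (by fun_prop)))

theorem exists_norm_cpow_le (A : Matrix ι ι ℂ) (a b : ℝ) :
    ∃ C, ∀ z : ℂ, z.re ∈ Set.Icc a b → ‖cpow A z‖ ≤ C := by
  obtain ⟨C, hC⟩ := isCompact_Icc.exists_bound_of_continuousOn (s := Set.Icc a b)
    (f := fun s : ℝ => cpow A s)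
    ((differentiable_cpow A).continuous.comp Complex.continuous_ofReal).continuousOn
  exact ⟨C, fun z hz => (norm_cpow_le_norm_cpow_re A z).trans (hC z.re hz)⟩

theorem exists_norm_interp_le (A K : Matrix ι ι ℂ) (t a b : ℝ) :
    ∃ C, ∀ z : ℂ, z.re ∈ Set.Icc a b → ‖interp A K t z‖ ≤ C := by
  obtain ⟨C₁, hC₁⟩ := exists_norm_cpow_le A a b
  obtain ⟨C₂, hC₂⟩ := exists_norm_cpow_le K (2 * a - 1) (2 * b - 1)
  obtain ⟨C₃, hC₃⟩ := exists_norm_cpow_le (K * A * K) (t - b) (t - a)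
  let tr := LinearMap.toContinuousLinearMap (traceLinearMap ι ℂ ℂ)
  refine ⟨‖tr‖ * (‖K‖ * C₁ * C₂ * C₃), fun z hz => (tr.le_opNorm _).trans ?_⟩
  have h₁ := hC₁ z hz
  have h₂ : ‖cpow K (2 * z - 1)‖ ≤ C₂ := hC₂ _ (by simpa using hz)
  have h₃ : ‖cpow (K * A * K) (t - z)‖ ≤ C₃ := hC₃ _ (by
    rw [Complex.sub_re, Complex.ofReal_re]
    exact ⟨sub_le_sub_left hz.2 t, sub_le_sub_left hz.1 t⟩)
  have h₁' := (norm_nonneg _).trans h₁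
  have h₂' := (norm_nonneg _).trans h₂
  refine mul_le_mul_of_nonneg_left (norm_mul₃_le.trans ?_) (norm_nonneg _)
  gcongr
  exact (norm_mul_le _ _).trans (by gcongr)

theorem exists_mpow_half_mul_eq (hA : A.PosDef) (hK : K.PosDef) :
    ∃ U ∈ unitary (Matrix ι ι ℂ), mpow A 2⁻¹ * K = U * mpow (K * A * K) 2⁻¹ := by
  have hX := conj_posDef hK hA
  set X := K * A * K
  refine ⟨mpow A 2⁻¹ * K * mpow X (-2⁻¹), ?_, ?_⟩
  · have h : star (mpow A 2⁻¹ * K * mpow X (-2⁻¹)) * (mpow A 2⁻¹ * K * mpow X (-2⁻¹)) = 1 := by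
      calc _ = mpow X (-2⁻¹) * (K * (mpow A 2⁻¹ * mpow A 2⁻¹) * K) * mpow X (-2⁻¹) := by
            simp only [star_eq_conjTranspose, conjTranspose_mul, (mpow_isHermitian _ _).eq,
              hK.1.eq, mul_assoc]
        _ = mpow X (-2⁻¹) * mpow X 1 * mpow X (-2⁻¹) := by
            rw [mpow_mul_mpow, mpow_one hX.posSemidef]
            norm_num [mpow_one hA.posSemidef]
            rfl
        _ = 1 := by
            rw [mpow_mul_mpow, mpow_mul_mpow, ← mpow_zero hX]
            norm_num
    exact Unitary.mem_iff.2 ⟨h, mul_eq_one_comm.1 h⟩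
  · rw [mul_assoc _ (mpow X _), mpow_mul_mpow, neg_add_cancel, mpow_zero hX, mul_one]

theorem exists_cpow_eq_mpow_mul_mul_mpow (hA : A.PosDef) (z : ℂ) :
    ∃ V ∈ unitary (Matrix ι ι ℂ), ∀ a b : ℝ, a + b = z.re → cpow A z = mpow A a * V * mpow A b := by
  refine ⟨_, cpow_ofReal_mul_I_mem_unitary A z.im, fun a b h => ?_⟩
  rw [← cpow_ofReal hA, ← cpow_ofReal hA, ← cpow_add, ← cpow_add]
  conv_lhs => rw [← Complex.re_add_im z, ← h]
  push_cast
  ring_nf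

theorem mpow_half_mul_star_eq {U : Matrix ι ι ℂ} (hK : K.IsHermitian)
    (hU : mpow A 2⁻¹ * K = U * mpow (K * A * K) 2⁻¹) :
    mpow (K * A * K) 2⁻¹ * star U = K * mpow A 2⁻¹ := by
  have := congrArg star hU
  simpa only [star_mul, star_eq_conjTranspose, (mpow_isHermitian _ _).eq, hK.eq] using this.symm

theorem norm_interp_le_of_re_eq_half (hA : A.PosDef) (hK : K.PosDef) {t : ℝ}
    (ht : 1 / 2 ≤ t) {z : ℂ} (hz : z.re = 1 / 2) :
    ‖interp A K t z‖ ≤ rtr (mpow (K * A * K) t) := by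
  obtain ⟨U, hU, hUA⟩ := exists_mpow_half_mul_eq hA hK
  have hX := conj_posDef hK hA
  obtain ⟨V, hV, hAz⟩ := exists_cpow_eq_mpow_mul_mul_mpow hA z
  obtain ⟨V', hV', hKz⟩ := exists_cpow_eq_mpow_mul_mul_mpow hK (2 * z - 1)
  obtain ⟨V'', hV'', hXz⟩ := exists_cpow_eq_mpow_mul_mul_mpow hX (t - z)
  have hF : interp A K t z = (mpow (K * A * K) 2⁻¹ * (star U * V * V' * V'') *
      mpow (K * A * K) (t - 2⁻¹) * 1).trace := by
    rw [interp, hAz 2⁻¹ 0 (by norm_num [hz]), hKz 0 0 (by norm_num [hz]),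
      hXz 0 (t - 2⁻¹) (by norm_num [hz]), mpow_zero hA, mpow_zero hK,
      mpow_zero hX]
    simp only [one_mul, mul_one, ← mul_assoc, mpow_half_mul_star_eq hK.1 hUA]
  rw [hF]
  simpa using norm_trace_mpow_mul_mul_mpow_mul_le hX
    (mul_mem (mul_mem (mul_mem (Unitary.star_mem hU) hV) hV') hV'') (one_mem _)
    (by norm_num : (0 : ℝ) ≤ 2⁻¹) (by linarith : 0 ≤ t - 2⁻¹) (by linarith)

theorem norm_interp_le_of_re_eq_one (hA : A.PosDef) (hK : K.PosDef) {t : ℝ}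
    (ht : 1 / 2 ≤ t) {z : ℂ} (hz : z.re = 1) :
    ‖interp A K t z‖ ≤ rtr (mpow (K * A * K) t) := by
  obtain ⟨U, hU, hUA⟩ := exists_mpow_half_mul_eq hA hK
  have hX := conj_posDef hK hA
  obtain ⟨V, hV, hAz⟩ := exists_cpow_eq_mpow_mul_mul_mpow hA z
  obtain ⟨V', hV', hKz⟩ := exists_cpow_eq_mpow_mul_mul_mpow hK (2 * z - 1)
  obtain ⟨V'', hV'', hXz⟩ := exists_cpow_eq_mpow_mul_mul_mpow hX (t - z)
  have hF : interp A K t z = (mpow (K * A * K) (t - 2⁻¹) * (star U * V * U) *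
      mpow (K * A * K) 2⁻¹ * (V' * V'')).trace := by
    calc interp A K t z = (K * mpow A 2⁻¹ * V * (mpow A 2⁻¹ * K) * V' *
          (V'' * mpow (K * A * K) (t - 1))).trace := by
          rw [interp, hAz 2⁻¹ 2⁻¹ (by norm_num [hz]), hKz 1 0 (by norm_num [hz]),
            hXz 0 (t - 1) (by norm_num [hz]), mpow_one hK.posSemidef, mpow_zero hK,
            mpow_zero hX]
          simp only [one_mul, mul_one, mul_assoc]
      _ = (mpow (K * A * K) (t - 1) * mpow (K * A * K) 2⁻¹ * (star U * V * U) *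
          mpow (K * A * K) 2⁻¹ * (V' * V'')).trace := by
          rw [← mpow_half_mul_star_eq hK.1 hUA, hUA, ← mul_assoc _ V'', trace_mul_comm]
          simp only [mul_assoc]
      _ = _ := by
          rw [mpow_mul_mpow]
          norm_num [sub_add]
  rw [hF]
  simpa using norm_trace_mpow_mul_mul_mpow_mul_le hX
    (mul_mem (mul_mem (Unitary.star_mem hU) hV) hU) (mul_mem hV' hV'')
    (by linarith : 0 ≤ t - 2⁻¹) (by norm_num : (0 : ℝ) ≤ 2⁻¹) (by linarith)

theorem rtr_mpow_mul_mpow_le (hA : A.PosDef) (hK : K.PosDef) {t : ℝ}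
    (h0 : 1 / 2 ≤ t) (h1 : t ≤ 1) :
    rtr (mpow A t * mpow K (2 * t)) ≤ rtr (mpow (K * A * K) t) := by
  have hX := conj_posDef hK hA
  have hF : rtr (mpow A t * mpow K (2 * t)) = (interp A K t t).re := by
    have : (2 * t - 1 : ℂ) = ((2 * t - 1 : ℝ) : ℂ) := by push_cast; ring
    rw [interp, this, sub_self, ← Complex.ofReal_zero, cpow_ofReal hA, cpow_ofReal hK,
      cpow_ofReal hX, mpow_zero hX, mul_one, mul_assoc, trace_mul_comm, mul_assoc, rtr]
    conv_rhs => enter [1, 1, 2, 2]; rw [← mpow_one hK.posSemidef]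
    rw [mpow_mul_mpow, sub_add_cancel]
  obtain ⟨C, hC⟩ := exists_norm_interp_le A K t (1 / 2) 1
  rw [hF]
  refine (Complex.re_le_norm _).trans (PhragmenLindelof.vertical_strip (a := 1 / 2) (b := 1)
    (differentiable_interp A K t).diffContOnCl ⟨0, by norm_num [Real.pi_pos], 0, ?_⟩
    (fun z => norm_interp_le_of_re_eq_half hA hK h0)
    (fun z => norm_interp_le_of_re_eq_one hA hK h0) h0 h1)
  refine Asymptotics.IsBigO.of_bound C ?_
  filter_upwards [mem_inf_of_right (mem_principal_self _)] with z hz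
  simpa using hC z ⟨hz.1.le, hz.2.le⟩

theorem Qold_le_Qnew (hA : A.PosDef) (hB : B.PosDef) {t : ℝ} (h0 : 1 / 2 ≤ t) (h1 : t ≤ 1) :
    Qold t A B ≤ Qnew t A B := by
  have hBt : mpow B (1 - t) = mpow (mpow B ((1 - t) / (2 * t))) (2 * t) := by
    rw [mpow_mpow hB.1, div_mul_cancel₀ _ (by linarith)]
  rw [Qold, hBt]
  exact rtr_mpow_mul_mpow_le hA (mpow_posDef hB _) h0 h1

theorem errorSum_posProj_le_two_mul_Qnew_of_posDef (hA : A.PosDef) (hB : B.PosDef) {t : ℝ}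
    (h0 : 0 < t) (h1 : t < 1) : errorSum A B (posProj (A - B)) ≤ 2 * Qnew t A B := by
  rcases le_total t (1 / 2) with ht | ht
  · obtain ⟨T, hT, hTQ⟩ := exists_isTest_errorSum_le_two_mul_Qnew hA hB h0 ht
    exact (errorSum_posProj_le hA.1 hB.1 hT).trans hTQ
  · calc errorSum A B (posProj (A - B)) ≤ Qold t A B :=
          errorSum_posProj_le_Qold hA.posSemidef hB.posSemidef h0 h1
      _ ≤ Qnew t A B := Qold_le_Qnew hA hB ht h1.le
      _ ≤ 2 * Qnew t A B := le_mul_of_one_le_left (Qnew_nonneg t A B) one_le_two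

theorem errorSum_posProj_le_two_mul_Qnew (hA : A.PosSemidef) (hB : B.PosSemidef) {t : ℝ}
    (h0 : 0 < t) (h1 : t < 1) : errorSum A B (posProj (A - B)) ≤ 2 * Qnew t A B := by
  have cA := continuous_add_smul_one A
  have cB := continuous_add_smul_one B
  have h := le_of_forall_pos_le (continuous_errorSum cA cB (posProj (A - B)))
    ((continuous_Qnew cA cB (add_smul_one_isHermitian hA.1)
      (add_smul_one_isHermitian hB.1) h0 h1).const_mul 2) fun ε hε => by
      simpa only [add_sub_add_right_eq_sub] using errorSum_posProj_le_two_mul_Qnew_of_posDef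
        (add_smul_one_posDef hA hε) (add_smul_one_posDef hB hε) h0 h1
  simpa using h

end ArakiLiebThirring

section OldDivergence

variable {ι : Type*} [Fintype ι] {ρ σ : Matrix ι ι ℂ}

theorem exists_mul_eq_of_supp_le (h : supp ρ ≤ supp σ) : ∃ M, σ * M = ρ := by
  classical
  have hcol (j : ι) : ∃ v : ι → ℂ, σ *ᵥ v = ρ.col j := h ⟨Pi.single j 1, by simp⟩
  choose v hv using hcol
  refine ⟨(Matrix.of v)ᵀ, ?_⟩
  ext i j
  simpa [Matrix.mul_apply, Matrix.mulVec, dotProduct] using congrFun (hv j) i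

variable [DecidableEq ι]

theorem rtr_eq_sum_eigenvalues (hρ : ρ.IsHermitian) : rtr ρ = ∑ i, hρ.eigenvalues i := by
  simp [rtr, hρ.trace_eq_sum_eigenvalues]

theorem IsState.le_one (hσ : IsState σ) : σ ≤ 1 := by
  refine (CFC.le_one_iff (R := ℝ) σ hσ.1.1.isSelfAdjoint).2 fun x hx => ?_
  rw [hσ.1.1.spectrum_real_eq_range_eigenvalues] at hx
  obtain ⟨i, rfl⟩ := hx
  rw [← hσ.rtr_eq_one, rtr_eq_sum_eigenvalues hσ.1.1]
  exact Finset.single_le_sum (fun j _ => hσ.1.eigenvalues_nonneg j) (Finset.mem_univ i)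

theorem mpow_le_mpow_of_exponent_ge (hσ : σ.IsHermitian) (h1 : σ ≤ 1) {a b : ℝ} (hab : b ≤ a) :
    mpow σ a ≤ mpow σ b := by
  refine cfc_mono (fun x hx => ?_) (continuousOn_spectrum _ _) (continuousOn_spectrum _ _)
  split_ifs with h
  · exact Real.rpow_le_rpow_of_exponent_ge h
      ((CFC.le_one_iff (R := ℝ) σ hσ.isSelfAdjoint).1 h1 x hx) hab
  · exact le_rfl

theorem Qold_one (hρ : ρ.PosSemidef) (hσ : σ.PosSemidef) (h : supp ρ ≤ supp σ) :
    Qold 1 ρ σ = rtr ρ := by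
  obtain ⟨M, hM⟩ := exists_mul_eq_of_supp_le h
  have hproj : mpow σ 0 * σ = σ := by
    conv_lhs => enter [2]; rw [← mpow_one hσ]
    rw [mpow_mul_mpow, zero_add, mpow_one hσ]
  rw [Qold, sub_self, mpow_one hρ, rtr_mul_comm, ← hM, ← mul_assoc, hproj]

theorem Qold_nonneg (t : ℝ) (ρ σ : Matrix ι ι ℂ) : 0 ≤ Qold t ρ σ :=
  rtr_mul_nonneg (mpow_posSemidef _ _) (mpow_posSemidef _ _)

theorem Qold_eq_sum (hρ : ρ.PosSemidef) (hσ : σ.PosSemidef) {t : ℝ} (h1 : t < 1) :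
    Qold t ρ σ = ∑ ij : ι × ι, (hρ.1.eigenvalues ij.1 * overlap hρ.1 hσ.1 ij.1 ij.2) *
      (hσ.1.eigenvalues ij.2 / hρ.1.eigenvalues ij.1) ^ (1 - t) := by
  rw [Qold, mpow, mpow, rtr_cfc_mul_cfc hρ.1 hσ.1, Fintype.sum_prod_type]
  refine Finset.sum_congr rfl fun i _ => Finset.sum_congr rfl fun j _ => ?_
  rcases (hρ.eigenvalues_nonneg i).eq_or_lt with hi | hi
  · simp [← hi]
  rcases (hσ.eigenvalues_nonneg j).eq_or_lt with hj | hj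
  · simp [← hj, Real.zero_rpow (sub_pos.2 h1).ne']
  have hpow : hρ.1.eigenvalues i ^ t = hρ.1.eigenvalues i / hρ.1.eigenvalues i ^ (1 - t) := by
    rw [eq_div_iff (Real.rpow_pos_of_pos hi _).ne', ← Real.rpow_add hi, add_sub_cancel,
      Real.rpow_one]
  rw [if_pos hi, if_pos hj, Real.div_rpow hj.le hi.le, hpow]
  ring

theorem Qold_le_rpow_mul_rpow (hρ : ρ.PosSemidef) (hσ : σ.PosSemidef) {s t : ℝ} (hst : s ≤ t)
    (h1 : t < 1) :
    Qold t ρ σ ≤ rtr ρ ^ (1 - (1 - t) / (1 - s)) * Qold s ρ σ ^ ((1 - t) / (1 - s)) := by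
  have ht : 0 < 1 - t := by linarith
  rw [Qold_eq_sum hρ hσ h1, Qold_eq_sum hρ hσ (hst.trans_lt h1)]
  set w : ι × ι → ℝ := fun ij => hρ.1.eigenvalues ij.1 * overlap hρ.1 hσ.1 ij.1 ij.2
  set z : ι × ι → ℝ := fun ij => hσ.1.eigenvalues ij.2 / hρ.1.eigenvalues ij.1
  have hz (ij : ι × ι) : 0 ≤ z ij :=
    div_nonneg (hσ.eigenvalues_nonneg _) (hρ.eigenvalues_nonneg _)
  have hw : ∑ ij, w ij = rtr ρ := by
    simp_rw [Fintype.sum_prod_type, w, ← Finset.mul_sum, sum_overlap_right, mul_one,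
      rtr_eq_sum_eigenvalues hρ.1]
  have holder := Real.inner_le_weight_mul_Lp_of_nonneg Finset.univ (p := (1 - s) / (1 - t))
    ((one_le_div ht).2 (by linarith)) w (fun ij => z ij ^ (1 - t))
    (fun ij => mul_nonneg (hρ.eigenvalues_nonneg _) (overlap_nonneg _ _ _ _))
    (fun ij => Real.rpow_nonneg (hz ij) _)
  simpa only [hw, inv_div, ← Real.rpow_mul (hz _), mul_div_cancel₀ _ ht.ne'] using holder

theorem rtr_mpow_le_card_rpow_mul (hρ : ρ.PosSemidef) {t : ℝ} (h0 : 0 < t) (h1 : t ≤ 1) :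
    rtr (mpow ρ t) ≤ (Fintype.card ι : ℝ) ^ (1 - t) * rtr ρ ^ t := by
  have holder := Real.inner_le_weight_mul_Lp_of_nonneg Finset.univ (p := t⁻¹)
    ((one_le_inv₀ h0).2 h1) (fun _ : ι => 1) (fun i => hρ.1.eigenvalues i ^ t)
    (fun _ => zero_le_one) (fun i => Real.rpow_nonneg (hρ.eigenvalues_nonneg i) _)
  have hpow (i : ι) : (hρ.1.eigenvalues i ^ t) ^ t⁻¹ = hρ.1.eigenvalues i :=
    Real.rpow_rpow_inv (hρ.eigenvalues_nonneg i) h0.ne'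
  simpa [hpow, rtr_mpow hρ h0, rtr_eq_sum_eigenvalues hρ.1] using holder

theorem Qnew_eq_rtr_mpow_conj (hρ : ρ.PosSemidef) (t : ℝ) (σ : Matrix ι ι ℂ) :
    Qnew t ρ σ = rtr (mpow (mpow ρ 2⁻¹ * mpow σ ((1 - t) / t) * mpow ρ 2⁻¹) t) := by
  have hsq : mpow ρ 2⁻¹ * mpow ρ 2⁻¹ = ρ := by
    rw [mpow_mul_mpow, ← two_mul, mul_inv_cancel₀ two_ne_zero, mpow_one hρ]
  have hσ : mpow σ ((1 - t) / (2 * t)) * mpow σ ((1 - t) / (2 * t)) = mpow σ ((1 - t) / t) := by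
    rw [mpow_mul_mpow, ← add_div, ← two_mul, mul_div_mul_left _ _ two_ne_zero]
  have h := rtr_mpow_conjTranspose_mul_self (mpow ρ 2⁻¹ * mpow σ ((1 - t) / (2 * t))) t
  rw [conjTranspose_mul, (mpow_isHermitian _ _).eq, (mpow_isHermitian _ _).eq] at h
  rw [Qnew, ← hσ]
  conv_lhs => rw [← hsq]
  simpa only [mul_assoc] using h

/-- Since `σ ^ ((1 - t) / t) ≤ σ ^ (1 - t)`, the left-hand side grows when the former is replaced by
the latter, after which it is `Q_t^{new}` of a pair with first trace `Q_t^{old}(ρ‖σ)`. -/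
theorem Qnew_le_Qnew_conj_mpow (hρ : ρ.PosSemidef) (hσ : σ.IsHermitian) (hσ1 : σ ≤ 1) {t : ℝ}
    (h0 : 0 < t) (h1 : t ≤ 1) : Qnew t ρ σ ≤
      Qnew t (mpow ρ (t / 2) * mpow σ (1 - t) * mpow ρ (t / 2)) (mpow ρ t) := by
  have hle : mpow σ ((1 - t) / t) ≤ mpow σ (1 - t) :=
    mpow_le_mpow_of_exponent_ge hσ hσ1 (le_div_self (sub_nonneg.2 h1) h0 h1)
  have hκ : 2⁻¹ = t * ((1 - t) / (2 * t)) + t / 2 := by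
    field_simp
    ring
  have left : mpow ρ 2⁻¹ = mpow ρ (t * ((1 - t) / (2 * t))) * mpow ρ (t / 2) := by
    rw [mpow_mul_mpow, ← hκ]
  have right : mpow ρ 2⁻¹ = mpow ρ (t / 2) * mpow ρ (t * ((1 - t) / (2 * t))) := by
    rw [mpow_mul_mpow, add_comm, ← hκ]
  calc Qnew t ρ σ = rtr (mpow (mpow ρ 2⁻¹ * mpow σ ((1 - t) / t) * mpow ρ 2⁻¹) t) :=
        Qnew_eq_rtr_mpow_conj hρ t σ
    _ ≤ rtr (mpow (mpow ρ 2⁻¹ * mpow σ (1 - t) * mpow ρ 2⁻¹) t) :=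
        rtr_mono (mpow_le_mpow (conj_posSemidef (mpow_isHermitian _ _) (mpow_posSemidef _ _))
          (conj_mono (mpow_isHermitian _ _) hle) h0 h1)
    _ = _ := by
        conv_lhs => enter [1, 1, 2]; rw [right]
        rw [Qnew, mpow_mpow hρ.1, left]
        simp only [mul_assoc]

theorem Qnew_le_of_Qold_le (hρ : IsState ρ) (hσ : IsState σ) {t : ℝ} (h0 : 0 < t) (h1 : t < 1)
    {u v : ℝ} (hu : 0 < u) (hv : 0 < v) (hQ : Qold t ρ σ ≤ u) (hcard : (Fintype.card ι : ℝ) ≤ v) :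
    Qnew t ρ σ ≤ u ^ t * (v ^ (1 - t)) ^ (1 - t) := by
  have hQold : rtr (mpow ρ (t / 2) * mpow σ (1 - t) * mpow ρ (t / 2)) = Qold t ρ σ := by
    rw [rtr_mul_comm, ← mul_assoc, mpow_mul_mpow, add_halves, Qold]
  have hdim : rtr (mpow ρ t) ≤ v ^ (1 - t) := by
    have h := rtr_mpow_le_card_rpow_mul hρ.1 h0 h1.le
    rw [hρ.rtr_eq_one, Real.one_rpow, mul_one] at h
    exact h.trans (Real.rpow_le_rpow (Nat.cast_nonneg _) hcard (by linarith))
  exact (Qnew_le_Qnew_conj_mpow hρ.1 hσ.1.1 hσ.le_one h0 h1.le).trans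
    (Qnew_le_rpow_mul_rpow (conj_posSemidef (mpow_isHermitian _ _) (mpow_posSemidef _ _))
      (mpow_posSemidef _ _) h0 h1 hu (Real.rpow_pos_of_pos hv _) (hQold.trans_le hQ) hdim)

end OldDivergence

section Rates

theorem elog_of_nonpos {x : ℝ} (hx : x ≤ 0) : elog x = ⊥ := by
  rw [elog, ENNReal.log_ofReal, if_pos hx]

theorem elog_of_pos {x : ℝ} (hx : 0 < x) : elog x = (Real.log x : EReal) :=
  ENNReal.log_ofReal_of_pos hx

theorem eventually_le_exp_of_limsupRate_lt {x : ℕ → ℝ} {c : ℝ} (h : limsupRate x < (c : EReal)) :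
    ∀ᶠ n : ℕ in atTop, x n ≤ Real.exp (n * c) := by
  filter_upwards [eventually_lt_of_limsup_lt h, eventually_gt_atTop 0] with n hn hpos
  rcases le_or_gt (x n) 0 with hx | hx
  · exact hx.trans (Real.exp_pos _).le
  · rw [elog_of_pos hx, ← EReal.coe_mul, EReal.coe_lt_coe_iff,
      inv_mul_lt_iff₀ (Nat.cast_pos.2 hpos)] at hn
    exact ((Real.log_lt_iff_lt_exp hx).1 hn).le

theorem limsupRate_le_of_eventually_le {x : ℕ → ℝ} {C c : ℝ}
    (h : ∀ᶠ n : ℕ in atTop, x n ≤ C * Real.exp (n * c)) : limsupRate x ≤ (c : EReal) := by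
  set K := max C 1
  have hK : 0 < K := one_pos.trans_le (le_max_right C 1)
  have hlim : Tendsto (fun n : ℕ => (((n : ℝ)⁻¹ * Real.log K + c : ℝ) : EReal)) atTop
      (𝓝 ((c : ℝ) : EReal)) := by
    refine (continuous_coe_real_ereal.tendsto _).comp ?_
    simpa using ((tendsto_inv_atTop_nhds_zero_nat (𝕜 := ℝ)).mul_const (Real.log K)).add_const c
  rw [← hlim.limsup_eq]
  refine limsup_le_limsup ?_
  filter_upwards [h, eventually_gt_atTop 0] with n hn hpos
  have hn0 : (0 : ℝ) < n := Nat.cast_pos.2 hpos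
  rcases le_or_gt (x n) 0 with hx | hx
  · rw [elog_of_nonpos hx, EReal.coe_mul_bot_of_pos (inv_pos.2 hn0)]
    exact bot_le
  · have hlog : Real.log (x n) ≤ Real.log K + n * c := by
      rw [← Real.log_exp (n * c), ← Real.log_mul hK.ne' (Real.exp_pos _).ne']
      exact Real.log_le_log hx
        (hn.trans (mul_le_mul_of_nonneg_right (le_max_left C 1) (Real.exp_pos _).le))
    rw [elog_of_pos hx, ← EReal.coe_mul, EReal.coe_le_coe_iff]
    calc (n : ℝ)⁻¹ * Real.log (x n) ≤ (n : ℝ)⁻¹ * (Real.log K + n * c) := by gcongr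
      _ = (n : ℝ)⁻¹ * Real.log K + c := by rw [mul_add, inv_mul_cancel_left₀ hn0.ne']

theorem limsupRate_one : limsupRate (fun _ => 1) = 0 := by
  simp [limsupRate, elog_of_pos]

theorem coe_sub_le_neg_of_forall_lt {p q : EReal} {b : ℝ}
    (h : ∀ c : ℝ, p < (c : EReal) → q ≤ ((c - b : ℝ) : EReal)) : (b : EReal) - p ≤ -q := by
  rw [EReal.le_neg]
  refine EReal.le_of_forall_lt_iff_le.1 fun z hz => ?_
  have hp : p < ((z + b : ℝ) : EReal) := by
    induction p with
    | bot => exact EReal.bot_lt_coe _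
    | top => simp at hz
    | coe p =>
      norm_cast at hz ⊢
      linarith
  simpa using h _ hp

theorem coe_lt_div_coe_iff_of_neg {p : EReal} {r s : ℝ} (hs : s < 0) :
    (r : EReal) < p / (s : EReal) ↔ p < ((r * s : ℝ) : EReal) := by
  rw [EReal.div_eq_inv_mul, ← EReal.coe_inv]
  have hinv := inv_lt_zero.2 hs
  induction p with
  | bot =>
    rw [EReal.coe_mul_bot_of_neg hinv]
    exact iff_of_true (EReal.coe_lt_top _) (EReal.bot_lt_coe _)
  | top => simp [EReal.coe_mul_top_of_neg hinv]
  | coe p =>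
    rw [← EReal.coe_mul, EReal.coe_lt_coe_iff, EReal.coe_lt_coe_iff, ← div_eq_inv_mul,
      lt_div_iff_of_neg hs]

theorem coe_le_div_coe_of_neg {p : EReal} {r s : ℝ} (hs : s < 0)
    (h : p ≤ ((r * s : ℝ) : EReal)) : (r : EReal) ≤ p / (s : EReal) := by
  refine EReal.ge_of_forall_gt_iff_ge.1 fun z hz => ?_
  refine ((coe_lt_div_coe_iff_of_neg hs).2 (h.trans_lt ?_)).le
  norm_cast at hz ⊢
  exact mul_lt_mul_of_neg_right hz hs

end Rates

section CompositeHypothesis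

variable {ι : Type*} [Fintype ι] [DecidableEq ι] {κ : Type*}
  {ρ : κ → Matrix ι ι ℂ} {σ T : Matrix ι ι ℂ}

theorem typeII_nonneg (hσ : σ.PosSemidef) (hT : IsTest T) : 0 ≤ typeII σ T :=
  rtr_mul_nonneg hσ hT.1

theorem typeI_range_nonneg (hρ : ∀ i, (ρ i).PosSemidef) (hT : IsTest T) :
    0 ≤ typeI (Set.range ρ) T := by
  refine Real.sSup_nonneg ?_
  rintro _ ⟨_, ⟨i, rfl⟩, rfl⟩
  exact rtr_mul_nonneg (hρ i) hT.2

variable [Fintype κ]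

theorem typeI_range_le (hρ : ∀ i, (ρ i).PosSemidef) (hT : IsTest T) :
    typeI (Set.range ρ) T ≤ rtr ((∑ i, ρ i) * (1 - T)) := by
  have hnonneg (i : κ) : 0 ≤ rtr (ρ i * (1 - T)) := rtr_mul_nonneg (hρ i) hT.2
  rw [Finset.sum_mul, rtr_sum]
  refine Real.sSup_le ?_ (Finset.sum_nonneg fun i _ => hnonneg i)
  rintro _ ⟨_, ⟨i, rfl⟩, rfl⟩
  exact Finset.single_le_sum (fun i _ => hnonneg i) (Finset.mem_univ i)

theorem posProj_smul_sum_sub_isTest (hρ : ∀ i, (ρ i).PosSemidef) (hσ : σ.PosSemidef) {c : ℝ}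
    (hc : 0 ≤ c) : IsTest (posProj (c • ∑ i, ρ i - σ)) :=
  posProj_isTest (((posSemidef_sum _ fun i _ => hρ i).smul hc).1.sub hσ.1)

theorem mul_typeI_add_typeII_posProj_le (hρ : ∀ i, (ρ i).PosSemidef) (hσ : σ.PosSemidef) {c : ℝ}
    (hc : 0 < c) {t : ℝ} (h0 : 0 < t) (h1 : t < 1) :
    c * typeI (Set.range ρ) (posProj (c • ∑ i, ρ i - σ)) +
      typeII σ (posProj (c • ∑ i, ρ i - σ)) ≤ 2 * (c ^ t * ∑ i, Qnew t (ρ i) σ) := by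
  have hsum : (∑ i, ρ i).PosSemidef := posSemidef_sum _ fun i _ => hρ i
  set T := posProj (c • ∑ i, ρ i - σ)
  calc c * typeI (Set.range ρ) T + typeII σ T
      ≤ c * rtr ((∑ i, ρ i) * (1 - T)) + typeII σ T := by
        gcongr
        exact typeI_range_le hρ (posProj_smul_sum_sub_isTest hρ hσ hc.le)
    _ = errorSum (c • ∑ i, ρ i) σ T := by rw [errorSum, smul_mul_assoc, rtr_smul, typeII]
    _ ≤ 2 * Qnew t (c • ∑ i, ρ i) σ :=
        errorSum_posProj_le_two_mul_Qnew (hsum.smul hc.le) hσ h0 h1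
    _ ≤ 2 * (c ^ t * ∑ i, Qnew t (ρ i) σ) := by
        rw [Qnew_smul hsum hc]
        gcongr
        exact Qnew_sum_le _ (fun i _ => hρ i) h0 h1

end CompositeHypothesis

section ErrorExponents

variable {ι : ℕ → Type*} [∀ n, Fintype (ι n)] [∀ n, DecidableEq (ι n)] {r : ℕ}
  {ρ : Fin r → ∀ n, Matrix (ι n) (ι n) ℂ} {σ : ∀ n, Matrix (ι n) (ι n) ℂ}

theorem npTest_isTest (hρ : ∀ i n, (ρ i n).PosSemidef) (hσ : ∀ n, (σ n).PosSemidef) (n : ℕ)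
    (a : ℝ) : IsTest (npTest ρ σ n a) :=
  posProj_smul_sum_sub_isTest (hρ · n) (hσ n) (Real.exp_pos _).le

theorem exp_mul_typeI_add_typeII_npTest_le (hρ : ∀ i n, (ρ i n).PosSemidef)
    (hσ : ∀ n, (σ n).PosSemidef) (n : ℕ) (a : ℝ) {t c : ℝ} (h0 : 0 < t) (h1 : t < 1)
    (h : ∀ i, Qnew t (ρ i n) (σ n) ≤ Real.exp (n * c)) :
    Real.exp (-(n * a)) * typeI (Set.range fun i => ρ i n) (npTest ρ σ n a) +
      typeII (σ n) (npTest ρ σ n a) ≤ 2 * r * Real.exp (n * (c - a * t)) := by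
  have hsum : ∑ i, Qnew t (ρ i n) (σ n) ≤ r * Real.exp (n * c) := by
    simpa using Finset.sum_le_sum fun i (_ : i ∈ Finset.univ) => h i
  calc _ ≤ 2 * (Real.exp (-(n * a)) ^ t * ∑ i, Qnew t (ρ i n) (σ n)) :=
        mul_typeI_add_typeII_posProj_le (hρ · n) (hσ n) (Real.exp_pos _) h0 h1
    _ ≤ 2 * (Real.exp (-(n * a)) ^ t * (r * Real.exp (n * c))) := by gcongr
    _ = 2 * r * (Real.exp (-(n * a) * t) * Real.exp (n * c)) := by
        rw [Real.exp_mul (-(n * a))]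
        ring
    _ = 2 * r * Real.exp (n * (c - a * t)) := by
        rw [← Real.exp_add]
        congr 2
        ring

theorem typeII_npTest_le (hρ : ∀ i n, (ρ i n).PosSemidef) (hσ : ∀ n, (σ n).PosSemidef) (n : ℕ)
    (a : ℝ) {t c : ℝ} (h0 : 0 < t) (h1 : t < 1)
    (h : ∀ i, Qnew t (ρ i n) (σ n) ≤ Real.exp (n * c)) :
    typeII (σ n) (npTest ρ σ n a) ≤ 2 * r * Real.exp (n * (c - a * t)) :=
  (le_add_of_nonneg_left (mul_nonneg (Real.exp_pos _).le
    (typeI_range_nonneg (hρ · n) (npTest_isTest hρ hσ n a)))).trans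
    (exp_mul_typeI_add_typeII_npTest_le hρ hσ n a h0 h1 h)

theorem typeI_npTest_le (hρ : ∀ i n, (ρ i n).PosSemidef) (hσ : ∀ n, (σ n).PosSemidef) (n : ℕ)
    (a : ℝ) {t c : ℝ} (h0 : 0 < t) (h1 : t < 1)
    (h : ∀ i, Qnew t (ρ i n) (σ n) ≤ Real.exp (n * c)) :
    typeI (Set.range fun i => ρ i n) (npTest ρ σ n a) ≤
      2 * r * Real.exp (n * (c - a * (t - 1))) := by
  have hle : Real.exp (-(n * a)) * typeI (Set.range fun i => ρ i n) (npTest ρ σ n a) ≤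
      2 * r * Real.exp (n * (c - a * t)) :=
    (le_add_of_nonneg_right (typeII_nonneg (hσ n) (npTest_isTest hρ hσ n a))).trans
      (exp_mul_typeI_add_typeII_npTest_le hρ hσ n a h0 h1 h)
  have hexp : Real.exp (n * (c - a * (t - 1))) =
      Real.exp (n * a) * Real.exp (n * (c - a * t)) := by
    rw [← Real.exp_add]
    congr 1
    ring
  rw [Real.exp_neg, inv_mul_le_iff₀ (Real.exp_pos _)] at hle
  rw [hexp]
  linarith

theorem eventually_Qnew_le_of_iSup_psiNew_lt {t c : ℝ}
    (h : (⨆ i, psiNew (ρ i) σ t) < (c : EReal)) :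
    ∀ᶠ n : ℕ in atTop, ∀ i, Qnew t (ρ i n) (σ n) ≤ Real.exp (n * c) :=
  eventually_all.2 fun i => eventually_le_exp_of_limsupRate_lt ((le_iSup _ i).trans_lt h)

theorem limsupRate_typeI_npTest_le (hρ : ∀ i n, (ρ i n).PosSemidef)
    (hσ : ∀ n, (σ n).PosSemidef) (a : ℝ) :
    limsupRate (fun n => typeI (Set.range fun i => ρ i n) (npTest ρ σ n a)) ≤
      -(⨆ t ∈ Set.Ioo (0 : ℝ) 1, (((a * (t - 1) : ℝ) : EReal) - ⨆ i, psiNew (ρ i) σ t)) := by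
  rw [EReal.le_neg]
  refine iSup₂_le fun t ht => coe_sub_le_neg_of_forall_lt fun c hc =>
    limsupRate_le_of_eventually_le (C := 2 * r) ?_
  filter_upwards [eventually_Qnew_le_of_iSup_psiNew_lt hc] with n hn
  exact typeI_npTest_le hρ hσ n a ht.1 ht.2 hn

theorem limsupRate_typeII_npTest_le (hρ : ∀ i n, (ρ i n).PosSemidef)
    (hσ : ∀ n, (σ n).PosSemidef) (a : ℝ) :
    limsupRate (fun n => typeII (σ n) (npTest ρ σ n a)) ≤
      -(⨆ t ∈ Set.Ioo (0 : ℝ) 1, (((a * t : ℝ) : EReal) - ⨆ i, psiNew (ρ i) σ t)) := by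
  rw [EReal.le_neg]
  refine iSup₂_le fun t ht => coe_sub_le_neg_of_forall_lt fun c hc =>
    limsupRate_le_of_eventually_le (C := 2 * r) ?_
  filter_upwards [eventually_Qnew_le_of_iSup_psiNew_lt hc] with n hn
  exact typeII_npTest_le hρ hσ n a ht.1 ht.2 hn

theorem psiNew_nonpos {ρ : ∀ n, Matrix (ι n) (ι n) ℂ} (hρ : ∀ n, IsState (ρ n))
    (hσ : ∀ n, IsState (σ n)) {t : ℝ} (h0 : 0 < t) (h1 : t < 1) : psiNew ρ σ t ≤ 0 := by
  refine limsupRate_le_of_eventually_le (C := 1) (c := 0) (Eventually.of_forall fun n => ?_)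
  have h := Qnew_le_add (hρ n).1 (hσ n).1 h0 h1
  simpa [(hρ n).rtr_eq_one, (hσ n).rtr_eq_one] using h

theorem neg_iSup_sub_iSup_psiNew_le (hρ : ∀ i n, IsState (ρ i n)) (hσ : ∀ n, IsState (σ n))
    (a : ℝ) :
    -(⨆ t ∈ Set.Ioo (0 : ℝ) 1, (((a * t : ℝ) : EReal) - ⨆ i, psiNew (ρ i) σ t)) ≤
      ((-a : ℝ) : EReal) := by
  rw [EReal.coe_neg, EReal.neg_le_neg_iff]
  have hlim : Tendsto (fun t : ℝ => ((a * t : ℝ) : EReal)) (𝓝[<] 1) (𝓝 ((a : ℝ) : EReal)) := by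
    have hcont : Continuous fun t : ℝ => ((a * t : ℝ) : EReal) :=
      continuous_coe_real_ereal.comp (continuous_const_mul a)
    simpa using (hcont.tendsto 1).mono_left nhdsWithin_le_nhds
  refine le_of_tendsto hlim ?_
  filter_upwards [Ioo_mem_nhdsLT (zero_lt_one' ℝ)] with t ht
  calc ((a * t : ℝ) : EReal) = ((a * t : ℝ) : EReal) - 0 := (sub_zero _).symm
    _ ≤ ((a * t : ℝ) : EReal) - ⨆ i, psiNew (ρ i) σ t :=
        EReal.sub_le_sub le_rfl (iSup_le fun i => psiNew_nonpos (hρ i) hσ ht.1 ht.2)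
    _ ≤ _ := le_iSup₂ (f := fun t (_ : t ∈ Set.Ioo (0 : ℝ) 1) =>
        ((a * t : ℝ) : EReal) - ⨆ i, psiNew (ρ i) σ t) t ht

end ErrorExponents

section DirectRate

variable {ι : ℕ → Type*} [∀ n, Fintype (ι n)] [∀ n, DecidableEq (ι n)]
  {N : ∀ n, Set (Matrix (ι n) (ι n) ℂ)} {σ : ∀ n, Matrix (ι n) (ι n) ℂ}

theorem le_directRate {R : ℝ} (h : IsAchievable N σ R) : (R : EReal) ≤ directRate N σ :=
  le_sSup ⟨R, h, rfl⟩

theorem le_directRate_of_forall_lt (h0 : IsAchievable N σ 0) {d : EReal}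
    (h : ∀ R R' : ℝ, 0 ≤ R → R < R' → (R' : EReal) < d → IsAchievable N σ R) :
    d ≤ directRate N σ := by
  by_contra! hlt
  obtain ⟨R, hR, hRd⟩ := EReal.lt_iff_exists_real_btwn.1 hlt
  obtain ⟨R', hRR', hR'd⟩ := EReal.lt_iff_exists_real_btwn.1 hRd
  have hR0 : 0 ≤ R := EReal.coe_le_coe_iff.1 ((le_directRate h0).trans hR.le)
  exact hR.not_ge (le_directRate (h R R' hR0 (EReal.coe_lt_coe_iff.1 hRR') hR'd))

variable {r : ℕ} {ρ : Fin r → ∀ n, Matrix (ι n) (ι n) ℂ}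

theorem isAchievable_of_eventually_Qnew_le (hρ : ∀ i n, (ρ i n).PosSemidef)
    (hσ : ∀ n, (σ n).PosSemidef) {t R R' : ℝ} (h0 : 0 < t) (h1 : t < 1) (hR : 0 ≤ R)
    (hRR' : R < R')
    (h : ∀ i, ∀ᶠ n : ℕ in atTop, Qnew t (ρ i n) (σ n) ≤ Real.exp (n * ((t - 1) * R'))) :
    IsAchievable (fun n => Set.range fun i => ρ i n) σ R := by
  have htest (n : ℕ) : IsTest (npTest ρ σ n R) := npTest_isTest hρ hσ n R
  refine ⟨hR, fun n => npTest ρ σ n R, htest, ?_, ?_⟩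
  · have hneg : (t - 1) * R' - R * (t - 1) < 0 := by nlinarith
    have hlim : Tendsto (fun n : ℕ => 2 * r * Real.exp (n * ((t - 1) * R' - R * (t - 1)))) atTop
        (𝓝 0) := by
      simpa using (Real.tendsto_exp_atBot.comp
        (tendsto_natCast_atTop_atTop.atTop_mul_const_of_neg hneg)).const_mul (2 * (r : ℝ))
    refine squeeze_zero' (Eventually.of_forall fun n => typeI_range_nonneg (hρ · n) (htest n))
      ?_ hlim
    filter_upwards [eventually_all.2 h] with n hn
    exact typeI_npTest_le hρ hσ n R h0 h1 hn
  · calc limsupRate (fun n => typeII (σ n) (npTest ρ σ n R))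
        ≤ (((t - 1) * R' - R * t : ℝ) : EReal) := by
          refine limsupRate_le_of_eventually_le (C := 2 * r) ?_
          filter_upwards [eventually_all.2 h] with n hn
          exact typeII_npTest_le hρ hσ n R h0 h1 hn
      _ ≤ ((-R : ℝ) : EReal) := EReal.coe_le_coe_iff.2 (by nlinarith)

theorem isAchievable_zero (hρ : ∀ i n, (ρ i n).PosSemidef) (hσ : ∀ n, IsState (σ n)) :
    IsAchievable (fun n => Set.range fun i => ρ i n) σ 0 := by
  have htest (n : ℕ) : IsTest (1 : Matrix (ι n) (ι n) ℂ) :=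
    ⟨PosSemidef.one, by rw [sub_self]; exact PosSemidef.zero⟩
  refine ⟨le_rfl, fun n => 1, htest, ?_, ?_⟩
  · refine tendsto_const_nhds.congr fun n =>
      le_antisymm (typeI_range_nonneg (hρ · n) (htest n)) ?_
    simpa [rtr] using typeI_range_le (hρ · n) (htest n)
  · simp [typeII, (hσ _).rtr_eq_one, limsupRate_one]

theorem Qnew_le_exp_of_lt_Dnew {κ : Type*} [Fintype κ] [DecidableEq κ] {ρ σ : Matrix κ κ ℂ}
    (hρ : rtr ρ = 1) {t c : ℝ} (h0 : 0 < t) (h1 : t < 1) {n : ℕ} (hn : 0 < n)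
    (h : (c : EReal) < (((n : ℝ)⁻¹ : ℝ) : EReal) * Dnew t ρ σ) :
    Qnew t ρ σ ≤ Real.exp (n * ((t - 1) * c)) := by
  rcases le_or_gt (Qnew t ρ σ) 0 with hQ | hQ
  · exact hQ.trans (Real.exp_pos _).le
  have hD : Dnew t ρ σ = ((Real.log (Qnew t ρ σ) / (t - 1) : ℝ) : EReal) := by
    rw [Dnew, if_pos (Or.inl ⟨h0, h1⟩), hρ, elog_of_pos hQ, elog_of_pos one_pos, Real.log_one,
      EReal.coe_zero, mul_zero, sub_zero, ← EReal.coe_mul, div_eq_inv_mul]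
  rw [hD, ← EReal.coe_mul, EReal.coe_lt_coe_iff, lt_inv_mul_iff₀ (Nat.cast_pos.2 hn),
    lt_div_iff_of_neg (by linarith)] at h
  exact (Real.log_le_iff_le_exp hQ).1 (h.le.trans_eq (by ring))

theorem iSup_iInf_liminf_Dnew_le_directRate (hρ : ∀ i n, IsState (ρ i n))
    (hσ : ∀ n, IsState (σ n)) :
    (⨆ t ∈ Set.Ioo (0 : ℝ) 1, ⨅ i, liminf (fun n : ℕ =>
      (((n : ℝ)⁻¹ : ℝ) : EReal) * Dnew t (ρ i n) (σ n)) atTop) ≤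
      directRate (fun n => Set.range fun i => ρ i n) σ := by
  have hρpos (i n) : (ρ i n).PosSemidef := (hρ i n).1
  refine iSup₂_le fun t ht => le_directRate_of_forall_lt (isAchievable_zero hρpos hσ)
    fun R R' hR hRR' hR' => ?_
  refine isAchievable_of_eventually_Qnew_le hρpos (fun n => (hσ n).1) ht.1 ht.2 hR hRR'
    fun i => ?_
  filter_upwards [eventually_lt_of_lt_liminf (hR'.trans_le (iInf_le _ i)),
    eventually_gt_atTop 0] with n hn hpos
  exact Qnew_le_exp_of_lt_Dnew (hρ i n).rtr_eq_one ht.1 ht.2 hpos hn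

end DirectRate

section LeftDerivative

variable {ι : ℕ → Type*} [∀ n, Fintype (ι n)] [∀ n, DecidableEq (ι n)]
  {ρ σ : ∀ n, Matrix (ι n) (ι n) ℂ}

theorem psiOld_one (hρ : ∀ n, IsState (ρ n)) (hσ : ∀ n, (σ n).PosSemidef)
    (hsupp : ∀ n, supp (ρ n) ≤ supp (σ n)) : psiOld ρ σ 1 = 0 := by
  have hQ (n : ℕ) : Qold 1 (ρ n) (σ n) = 1 :=
    (Qold_one (hρ n).1 (hσ n) (hsupp n)).trans (hρ n).rtr_eq_one
  rw [psiOld, funext hQ, limsupRate_one]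

theorem psiOld_div_mono (hρ : ∀ n, IsState (ρ n)) (hσ : ∀ n, (σ n).PosSemidef) {s t : ℝ}
    (hst : s ≤ t) (h1 : t < 1) :
    psiOld ρ σ s / ((s - 1 : ℝ) : EReal) ≤ psiOld ρ σ t / ((t - 1 : ℝ) : EReal) := by
  have hs : 0 < 1 - s := by linarith
  have ht : 0 < 1 - t := by linarith
  refine EReal.ge_of_forall_gt_iff_ge.1 fun z hz => ?_
  rw [coe_lt_div_coe_iff_of_neg (by linarith)] at hz
  refine coe_le_div_coe_of_neg (by linarith) (limsupRate_le_of_eventually_le (C := 1) ?_)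
  filter_upwards [eventually_le_exp_of_limsupRate_lt hz] with n hn
  calc Qold t (ρ n) (σ n) ≤ Qold s (ρ n) (σ n) ^ ((1 - t) / (1 - s)) := by
        simpa [(hρ n).rtr_eq_one] using Qold_le_rpow_mul_rpow (hρ n).1 (hσ n) hst h1
    _ ≤ Real.exp (n * (z * (s - 1))) ^ ((1 - t) / (1 - s)) :=
        Real.rpow_le_rpow (Qold_nonneg _ _ _) hn (div_pos ht hs).le
    _ = 1 * Real.exp (n * (z * (t - 1))) := by
        rw [← Real.exp_mul, one_mul]
        congr 1
        field_simp
        ring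

theorem hasLeftDeriv_psiOld (hρ : ∀ n, IsState (ρ n)) (hσ : ∀ n, (σ n).PosSemidef)
    (hsupp : ∀ n, supp (ρ n) ≤ supp (σ n)) :
    HasLeftDeriv (psiOld ρ σ) 1
      (⨆ t ∈ Set.Ioo (0 : ℝ) 1, psiOld ρ σ t / ((t - 1 : ℝ) : EReal)) := by
  simp only [HasLeftDeriv, psiOld_one hρ hσ hsupp, sub_zero]
  refine tendsto_order.2 ⟨fun a ha => ?_, fun b hb => ?_⟩
  · simp only [lt_iSup_iff] at ha
    obtain ⟨s, hs, has⟩ := ha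
    filter_upwards [Ioo_mem_nhdsLT hs.2] with t ht
    exact has.trans_le (psiOld_div_mono hρ hσ ht.1.le ht.2)
  · filter_upwards [Ioo_mem_nhdsLT (zero_lt_one' ℝ)] with t ht
    exact (le_iSup₂ (f := fun t (_ : t ∈ Set.Ioo (0 : ℝ) 1) =>
      psiOld ρ σ t / ((t - 1 : ℝ) : EReal)) t ht).trans_lt hb

theorem eventually_Qnew_le_of_lt_psiOld_div (hρ : ∀ n, IsState (ρ n)) (hσ : ∀ n, IsState (σ n))
    {t c R : ℝ} (h0 : 0 < t) (h1 : t < 1)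
    (hcard : ∀ᶠ n : ℕ in atTop, (Fintype.card (ι n) : ℝ) ≤ Real.exp (n * c))
    (hR : (R : EReal) < psiOld ρ σ t / ((t - 1 : ℝ) : EReal)) :
    ∀ᶠ n : ℕ in atTop,
      Qnew t (ρ n) (σ n) ≤ Real.exp (n * ((t - 1) * (t * R - (1 - t) * c))) := by
  have hψ := (coe_lt_div_coe_iff_of_neg (by linarith)).1 hR
  filter_upwards [eventually_le_exp_of_limsupRate_lt hψ, hcard] with n hQ hdim
  refine (Qnew_le_of_Qold_le (hρ n) (hσ n) h0 h1 (Real.exp_pos _) (Real.exp_pos _) hQ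
    hdim).trans_eq ?_
  rw [← Real.exp_mul, ← Real.exp_mul, ← Real.exp_mul, ← Real.exp_add]
  congr 1
  ring

theorem iInf_leftDeriv_le_directRate {r : ℕ} {ρ : Fin r → ∀ n, Matrix (ι n) (ι n) ℂ}
    (hρ : ∀ i n, IsState (ρ i n)) (hσ : ∀ n, IsState (σ n))
    (hsupp : ∀ i n, supp (ρ i n) ≤ supp (σ n))
    (hdim : limsupRate (fun n => (Fintype.card (ι n) : ℝ)) < ⊤) {d : Fin r → EReal}
    (hd : ∀ i, HasLeftDeriv (psiOld (ρ i) σ) 1 (d i)) :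
    (⨅ i, d i) ≤ directRate (fun n => Set.range fun i => ρ i n) σ := by
  have hρpos (i n) : (ρ i n).PosSemidef := (hρ i n).1
  have hσpos (n) : (σ n).PosSemidef := (hσ n).1
  obtain ⟨c, hc, -⟩ := EReal.lt_iff_exists_real_btwn.1 hdim
  refine le_directRate_of_forall_lt (isAchievable_zero hρpos hσ) fun R R' hR hRR' hR' => ?_
  have hslope : ∀ᶠ t in 𝓝[<] (1 : ℝ), ∀ i,
      (R' : EReal) < psiOld (ρ i) σ t / ((t - 1 : ℝ) : EReal) := by
    refine eventually_all.2 fun i => ?_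
    have hi := hd i
    simp only [HasLeftDeriv, psiOld_one (hρ i) hσpos (hsupp i), sub_zero] at hi
    exact hi.eventually_const_lt (hR'.trans_le (iInf_le _ i))
  have hroom : ∀ᶠ t in 𝓝[<] (1 : ℝ), R < t * R' - (1 - t) * c := by
    have hcont : Continuous fun t : ℝ => t * R' - (1 - t) * c := by fun_prop
    exact ((hcont.tendsto 1).mono_left nhdsWithin_le_nhds).eventually_const_lt (by simpa)
  obtain ⟨t, hψ, hRt, ht⟩ :=
    (hslope.and (hroom.and (Ioo_mem_nhdsLT (zero_lt_one' ℝ)))).exists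
  exact isAchievable_of_eventually_Qnew_le hρpos hσpos ht.1 ht.2 hR hRt fun i =>
    eventually_Qnew_le_of_lt_psiOld_div (hρ i) hσ ht.1 ht.2
      (eventually_le_exp_of_limsupRate_lt hc) (hψ i)

end LeftDerivative

end QHT

theorem mainTheorem8 {ι : ℕ → Type*} [∀ n, Fintype (ι n)] [∀ n, DecidableEq (ι n)]
    (r : ℕ) (hr : 0 < r)
    (ρ : Fin r → ∀ n, Matrix (ι n) (ι n) ℂ) (σ : ∀ n, Matrix (ι n) (ι n) ℂ)
    (hρ : ∀ i n, QHT.IsState (ρ i n)) (hσ : ∀ n, QHT.IsState (σ n))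
    (hsupp : ∀ i n, QHT.supp (ρ i n) ≤ QHT.supp (σ n))
    (N : ∀ n, Set (Matrix (ι n) (ι n) ℂ)) (hN : ∀ n, N n = Set.range fun i => ρ i n) :
    (∀ a : ℝ,
      QHT.limsupRate (fun n => QHT.typeI (N n) (QHT.npTest ρ σ n a)) ≤
        -(⨆ t ∈ Set.Ioo (0 : ℝ) 1,
            (((a * (t - 1) : ℝ) : EReal) - ⨆ i, QHT.psiNew (ρ i) σ t)) ∧
      QHT.limsupRate (fun n => QHT.typeII (σ n) (QHT.npTest ρ σ n a)) ≤
        -(⨆ t ∈ Set.Ioo (0 : ℝ) 1,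
            (((a * t : ℝ) : EReal) - ⨆ i, QHT.psiNew (ρ i) σ t)) ∧
      -(⨆ t ∈ Set.Ioo (0 : ℝ) 1,
            (((a * t : ℝ) : EReal) - ⨆ i, QHT.psiNew (ρ i) σ t)) ≤ ((-a : ℝ) : EReal)) ∧
    (⨆ t ∈ Set.Ioo (0 : ℝ) 1, ⨅ i,
        liminf (fun n : ℕ =>
          (((n : ℝ)⁻¹ : ℝ) : EReal) * QHT.Dnew t (ρ i n) (σ n)) atTop) ≤
      QHT.directRate N σ ∧
    (QHT.limsupRate (fun n => (Fintype.card (ι n) : ℝ)) < ⊤ →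
      ∃ d : Fin r → EReal,
        (∀ i, QHT.HasLeftDeriv (QHT.psiOld (ρ i) σ) 1 (d i)) ∧
        (⨅ i, d i) ≤ QHT.directRate N σ) := by
  obtain rfl : N = fun n => Set.range fun i => ρ i n := funext hN
  have hρpos (i n) : (ρ i n).PosSemidef := (hρ i n).1
  have hσpos (n) : (σ n).PosSemidef := (hσ n).1
  refine ⟨fun a => ⟨QHT.limsupRate_typeI_npTest_le hρpos hσpos a,
    QHT.limsupRate_typeII_npTest_le hρpos hσpos a, QHT.neg_iSup_sub_iSup_psiNew_le hρ hσ a⟩,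
    QHT.iSup_iInf_liminf_Dnew_le_directRate hρ hσ, fun hdim => ?_⟩
  have hderiv := fun i => QHT.hasLeftDeriv_psiOld (hρ i) hσpos (hsupp i)
  exact ⟨_, hderiv, QHT.iInf_leftDeriv_le_directRate hρ hσ hsupp hdim hderiv⟩
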